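/- Let $k\ge 2$. For $n\ge 2k+1$ consider a convex $n$-gon with vertices labelled $1,\dots,n$ in cyclic order; its diagonals are written $(a,b)$ with $a<b$. Two diagonals cross if they intersect in their interiors, an $m$-crossing is a set of $m$ pairwise crossing diagonals, and a $k$-triangulation is a maximal set of diagonals containing no $(k+1)$-crossing. A diagonal $(a,b)$ with $2\le b-a\le k$ or $2\le n-(b-a)\le k$ is called trivial. All $k$-triangulations contain the trivial diagonals, which are ignored from now on: a $k$-triangulation is represented by its diagram, the set of its diagonals in $\Lambda_n=\{(a,b): 1\le a<b-k\le n-k,\ a>b-n+k\}$, with $(a,b)$ drawn as a cross in row $a$ and column $b$. Let $\mathcal T_n$ be the set of these diagrams. For $n\ge 2k+2$ and $T\in\mathcal T_n$ let the corner $r$ of $T$ be the largest $a$ with $1\le a\le n-k-1$ and $(a,a+k+1)\in T$. (The corner of the empty diagram for $n=2k+1$ is $k$ by convention.) For $1\le i\le k$ let $A_i=\{a:(a,r+i)\in T\}\cup\{r+i-k\}$, $a_1=\min A_1$ and $a_i=\min\{a\in A_i: a>a_{i-1}\}$ for $i\ge 2$. The parent diagram $p(T)$ is obtained from $T$ as follows.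 * Delete the squares $(a,a+k+1)$ for $a=r,r+1,\dots,n-k-1$. * For each $i=1,\dots,k-1$: keep the crosses $(a,r+i)$ with $a\ge a_i$ in column $r+i$; move the crosses $(a,r+i+1)$ with $a<a_i$ to column $r+i$; delete the cross $(a_i,r+i+1)$ if it is in $T$. * Delete column $r+k$ and move all columns to the right of it one position to the left. Delete also the squares $(a,n-k-1+a)$ for $1\le a\le r+2k-n$. **Parents.** Let $n\ge 2k+2$ and $T\in\mathcal T_n$. The corner $r$ exists, $r\ge k$, $T$ has no crosses below row $r$, and the minima defining $a_1,\dots,a_k$ exist. For every $1\le i\le k$, either $(a_i,r+i+1)\in T$ or $(a_i,r+i+1)$ is a trivial diagonal. Column $r+k$ of $T$ has no crosses below row $a_{k-1}$. Finally, $p(T)\in\mathcal T_{n-1}$. **Generating tree.** $\mathcal T_{2k+1}=\{\emptyset\}$, and the graph whose nodes are the elements of all $\mathcal T_n$, $n\ge 2k+1$ (as a disjoint union), and whose edges join each $T\in\mathcal T_n$, $n\ge 2k+2$, to $p(T)\in\mathcal T_{n-1}$, is a tree. Rooted at $\emptyset\in\mathcal T_{2k+1}$, its nodes at level $\ell$ (distance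 $\ell$ from the root) are exactly the elements of $\mathcal T_{\ell+2k+1}$. **Children.** Let $n\ge 2k+1$ and let $T\in\mathcal T_n$ have corner $r$. The children of $T$, that is, the $\widehat T\in\mathcal T_{n+1}$ with $p(\widehat T)=T$, are exactly the diagrams obtained as follows, and different choices of $u$ and $b_1,\dots,b_{k-1}$ give different children. * Choose $u\in\{r,\dots,n-k\}$. * Add one to the labels of the columns $j$ with $u+k\le j\le n$, and add an empty column labelled $u+k$. * Add a cross $(u,u+k+1)$, and enlarge the board by empty squares to $\Lambda_{n+1}$. * For $1\le i\le k-1$ let $B_i=\{b:(b,u+i)\in T\}\cup\{u+i-k\}$, together with the additional element $i$ if $u=n-k$. Choose $b_i\in B_i$ with $b_1<b_2<\cdots<b_{k-1}$. * For $i=k-1,k-2,\dots,1$, add a cross $(b_i,u+i+1)$ (except if $u=n-k$ and $b_i=i$, in which case the cross $(b_i,u+i)$ is added instead), and move all crosses $(b,u+i)$ with $b<b_i$ from column $u+i$ to column $u+i+1$. The child obtained from $u,b_1,\dots,b_{k-1}$ has corner $u$. In particular, every child of $T$ has corner at least $r$. -/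

import Mathlib

namespace KTri

/-- The diagonals of a convex `n`-gon with vertices `1, …, n`: pairs `(a, b)` with `a < b`
that are not sides, the sides being `(a, a + 1)` and `(1, n)`. -/
def diagonals (n : ℕ) : Set (ℕ × ℕ) :=
  {d | 1 ≤ d.1 ∧ d.1 + 2 ≤ d.2 ∧ d.2 ≤ n ∧ d ≠ (1, n)}

/-- Two diagonals of a convex polygon intersect in their interiors iff their endpoints interlace. -/
def Crosses (d e : ℕ × ℕ) : Prop :=
  (d.1 < e.1 ∧ e.1 < d.2 ∧ d.2 < e.2) ∨ (e.1 < d.1 ∧ d.1 < e.2 ∧ e.2 < d.2)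

/-- `S` contains an `m`-crossing: `m` diagonals any two of which cross. -/
def HasCrossing (m : ℕ) (S : Set (ℕ × ℕ)) : Prop :=
  ∃ C : Finset (ℕ × ℕ), (C : Set (ℕ × ℕ)) ⊆ S ∧ C.card = m ∧ (C : Set (ℕ × ℕ)).Pairwise Crosses

/-- A `k`-triangulation of the `n`-gon: a maximal set of diagonals without `(k + 1)`-crossing.
Here the trivial diagonals are still present. -/
def IsKTriangulation (k n : ℕ) (S : Set (ℕ × ℕ)) : Prop :=
  Maximal (fun S : Set (ℕ × ℕ) => S ⊆ diagonals n ∧ ¬ HasCrossing (k + 1) S) S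

/-- Trivial diagonals: those with fewer than `k` vertices strictly on one side, that is
`(a, a + j)`, or `(a, b)` with `a = b + j - n`, for `2 ≤ j ≤ k`. -/
def IsTrivial (k n : ℕ) (d : ℕ × ℕ) : Prop :=
  d ∈ diagonals n ∧ ∃ j, 2 ≤ j ∧ j ≤ k ∧ (d.2 = d.1 + j ∨ d.1 + n = d.2 + j)

/-- The shape `Λ_n^{(k)}`: the nontrivial diagonals of the `n`-gon, as squares (row, column). -/
def shape (k n : ℕ) : Set (ℕ × ℕ) :=
  {d | 1 ≤ d.1 ∧ d.1 + k < d.2 ∧ d.2 ≤ n ∧ d.2 + k < d.1 + n}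

/-- The `k`-triangulations of the `n`-gon with trivial diagonals ignored, that is, represented
by their diagrams as subsets of `shape k n`. -/
def kTriangulations (k n : ℕ) : Set (Set (ℕ × ℕ)) :=
  {T | ∃ S, IsKTriangulation k n S ∧ T = S ∩ shape k n}

/-- The rows of the short diagonals `(a, a + k + 1)` of `T`, `1 ≤ a ≤ n - k - 1`. -/
def shortRows (k n : ℕ) (T : Set (ℕ × ℕ)) : Set ℕ :=
  {a | 1 ≤ a ∧ a + k + 1 ≤ n ∧ (a, a + k + 1) ∈ T}

open Classical in
/-- The corner `r`: the largest row of a short diagonal. The `k`-triangulation without nontrivial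
diagonals (`n = 2k + 1`) has no short diagonal; its corner is `k = n - k - 1` by convention. -/
noncomputable def corner (k n : ℕ) (T : Set (ℕ × ℕ)) : ℕ :=
  if (shortRows k n T).Nonempty then sSup (shortRows k n T) else k

/-- `A_i = {a : (a, r + i) ∈ T} ∪ {r + i - k}`. -/
def setA (k r : ℕ) (T : Set (ℕ × ℕ)) (i : ℕ) : Set ℕ :=
  {a | (a, r + i) ∈ T} ∪ {r + i - k}

/-- `a_1 = min A_1` and `a_i = min {a ∈ A_i : a > a_{i-1}}` for `i ≥ 2`
(the value at `i = 0` is not used). -/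
noncomputable def idxA (k r : ℕ) (T : Set (ℕ × ℕ)) : ℕ → ℕ
  | 0 => 0
  | 1 => sInf (setA k r T 1)
  | i + 2 => sInf {a | a ∈ setA k r T (i + 2) ∧ idxA k r T (i + 1) < a}

/-- The diagram obtained from the diagram `T` of a `k`-triangulation of the `n`-gon by the parent
operation. A square `(x, y)` of the new diagram has a cross in exactly the following cases.
* `y ≤ r`: the column is unchanged.
* `y = r + i` with `1 ≤ i ≤ k - 1`: either the cross was there with `x ≥ a_i` and is kept, or it
  was in column `r + i + 1` with `x < a_i` and is moved; except that the squares
  `(a, n - k - 1 + a)` with `1 ≤ a ≤ r + 2k - n` are deleted.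
* `y ≥ r + k`: the cross comes from column `y + 1 ≥ r + k + 1`, the old column `r + k` having been
  deleted; except that the squares `(a, a + k + 1)` with `a ≥ r` are deleted first. -/
def parent (k n : ℕ) (T : Set (ℕ × ℕ)) : Set (ℕ × ℕ) :=
  {p | p.2 ≤ corner k n T ∧ p ∈ T} ∪
  {p | (∃ i, 1 ≤ i ∧ i + 1 ≤ k ∧ p.2 = corner k n T + i ∧
        ((idxA k (corner k n T) T i ≤ p.1 ∧ p ∈ T) ∨
         (p.1 < idxA k (corner k n T) T i ∧ (p.1, p.2 + 1) ∈ T))) ∧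
      ¬ (1 ≤ p.1 ∧ p.1 + n ≤ corner k n T + 2 * k ∧ p.2 + k + 1 = n + p.1)} ∪
  {p | corner k n T + k ≤ p.2 ∧ (p.1, p.2 + 1) ∈ T ∧
      ¬ (corner k n T ≤ p.1 ∧ p.2 + 1 = p.1 + k + 1)}

/-- `B_i = {b : (b, u + i) ∈ T} ∪ {u + i - k}`, together with the element `i` when `u = n - k`. -/
def setB (k n u : ℕ) (T : Set (ℕ × ℕ)) (i : ℕ) : Set ℕ :=
  {b | (b, u + i) ∈ T} ∪ {u + i - k} ∪ {b | u + k = n ∧ b = i}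

/-- The admissible choices `(u, b_1 < ⋯ < b_{k-1})`: `r ≤ u ≤ n - k` and `b_i ∈ B_i`. -/
def choices (k n : ℕ) (T : Set (ℕ × ℕ)) : Set (ℕ × (Set.Icc 1 (k - 1) → ℕ)) :=
  {c | corner k n T ≤ c.1 ∧ c.1 + k ≤ n ∧ (∀ i : Set.Icc 1 (k - 1), c.2 i ∈ setB k n c.1 T i) ∧ StrictMono c.2}

open Classical in
/-- The square of the cross added at step `i`: `(b_i, u + i + 1)`, but `(b_i, u + i)` if `b_i` is
the additional element `i` of `B_i` that is present when `u = n - k`. -/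
noncomputable def addedCross (k n u : ℕ) (b : Set.Icc 1 (k - 1) → ℕ) (i : Set.Icc 1 (k - 1)) :
    ℕ × ℕ :=
  if u + k = n ∧ b i = i then (b i, u + i) else (b i, u + i + 1)

/-- The child of `T` (a diagram for the `n`-gon) given by the choice of `u` and `b`. Its crosses:
* those of the columns `≤ u` of `T`, unchanged;
* those of the columns `≥ u + k` of `T`, moved one column to the right;
* for `1 ≤ i ≤ k - 1`, those of column `u + i` of `T` in rows `≥ b_i`, unchanged, and those of
  column `u + i` of `T` in rows `< b_i`, moved to column `u + i + 1`;
* the cross `(u, u + k + 1)` and the `k - 1` crosses added in the steps `i = k - 1, …, 1`. -/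
def child (k n : ℕ) (T : Set (ℕ × ℕ)) (u : ℕ) (b : Set.Icc 1 (k - 1) → ℕ) : Set (ℕ × ℕ) :=
  {p | p.2 ≤ u ∧ p ∈ T} ∪
  {p | ∃ y, u + k ≤ y ∧ p.2 = y + 1 ∧ (p.1, y) ∈ T} ∪
  {p | ∃ i : Set.Icc 1 (k - 1), p.2 = u + i ∧ b i ≤ p.1 ∧ p ∈ T} ∪
  {p | ∃ i : Set.Icc 1 (k - 1), p.2 = u + i + 1 ∧ p.1 < b i ∧ (p.1, u + (i : ℕ)) ∈ T} ∪
  {(u, u + k + 1)} ∪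
  Set.range (addedCross k n u b)

/-- Nodes of the generating tree: at level `ℓ`, the `k`-triangulations of an
`(ℓ + 2k + 1)`-gon. -/
abbrev Node (k : ℕ) : Type := Σ l : ℕ, ↥(kTriangulations k (l + 2 * k + 1))

/-- The node `x` is the parent of the node `y`. -/
def IsParent {k : ℕ} (x y : Node k) : Prop :=
  y.1 = x.1 + 1 ∧ (x.2 : Set (ℕ × ℕ)) = parent k (y.1 + 2 * k + 1) (y.2 : Set (ℕ × ℕ))

/-- The generating tree: the graph on all nodes joining every node to its parent. -/
def generatingTree (k : ℕ) : SimpleGraph (Node k) := SimpleGraph.fromRel IsParent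

/-- A trivial diagonal is in no `(k + 1)`-crossing of diagonals of the `n`-gon. -/
theorem not_mem_crossing {k n : ℕ} {C : Finset (ℕ × ℕ)} (hC : (C : Set (ℕ × ℕ)) ⊆ diagonals n)
    (hcard : C.card = k + 1) (hp : (C : Set (ℕ × ℕ)).Pairwise Crosses) {d : ℕ × ℕ} (hd : d ∈ C) :
    d ∈ shape k n := by
  have hdn := hC hd
  simp only [diagonals, Set.mem_ofPred_eq] at hdn
  have hcard' : (C.erase d).card = k := by rw [Finset.card_erase_of_mem hd, hcard]; rfl
  have hcr : ∀ e ∈ C.erase d, Crosses d e := fun e he =>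
    hp hd (Finset.mem_of_mem_erase he) (Finset.ne_of_mem_erase he).symm
  have hin : k ≤ (Finset.Ioo d.1 d.2).card := by
    rw [← hcard']
    apply Finset.card_le_card_of_injOn (fun e => if d.1 < e.1 then e.1 else e.2)
    · intro e he
      have := hcr e he
      simp only [Crosses] at this
      simp only [Finset.coe_Ioo, Set.mem_Ioo]
      split_ifs <;> omega
    · intro e he f hf hef
      by_contra hne
      have h1 := hcr e he
      have h2 := hcr f hf
      have h3 := hp (Finset.mem_of_mem_erase he) (Finset.mem_of_mem_erase hf) hne
      simp only [Crosses] at h1 h2 h3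
      simp only at hef
      split_ifs at hef <;> omega
  have hout : k ≤ ((Finset.Icc 1 n) \ (Finset.Icc d.1 d.2)).card := by
    rw [← hcard']
    apply Finset.card_le_card_of_injOn (fun e => if d.1 < e.1 then e.2 else e.1)
    · intro e he
      have := hcr e he
      have h' := hC (Finset.mem_of_mem_erase he)
      simp only [Crosses] at this
      simp only [diagonals, Set.mem_ofPred_eq] at h'
      simp only [Finset.coe_sdiff, Finset.coe_Icc, Set.mem_sdiff, Set.mem_Icc]
      split_ifs <;> omega
    · intro e he f hf hef
      by_contra hne
      have h1 := hcr e he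
      have h2 := hcr f hf
      have h3 := hp (Finset.mem_of_mem_erase he) (Finset.mem_of_mem_erase hf) hne
      simp only [Crosses] at h1 h2 h3
      simp only at hef
      split_ifs at hef <;> omega
  rw [Nat.card_Ioo] at hin
  rw [Finset.card_sdiff_of_subset (Finset.Icc_subset_Icc hdn.1 hdn.2.2.1), Nat.card_Icc,
    Nat.card_Icc] at hout
  simp only [shape, Set.mem_ofPred_eq]
  omega

/-- Ignoring trivial diagonals changes nothing: the diagrams are exactly the maximal subsets of
`shape k n` without `(k + 1)`-crossing. -/
theorem mem_kTriangulations_iff {k n : ℕ} (hk : 1 ≤ k) {T : Set (ℕ × ℕ)} :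
    T ∈ kTriangulations k n ↔
      Maximal (fun T : Set (ℕ × ℕ) => T ⊆ shape k n ∧ ¬ HasCrossing (k + 1) T) T := by
  have hsub : shape k n ⊆ diagonals n := by
    rintro ⟨a, b⟩ h
    simp only [shape, diagonals, Set.mem_ofPred_eq, ne_eq, Prod.mk.injEq] at h ⊢
    omega
  have key : ∀ S ⊆ diagonals n, ¬ HasCrossing (k + 1) (S ∩ shape k n) →
      ¬ HasCrossing (k + 1) S := by
    rintro S hS hn ⟨C, hCS, hc, hp⟩
    exact hn ⟨C, fun d hd => ⟨hCS hd, not_mem_crossing (hCS.trans hS) hc hp hd⟩, hc, hp⟩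
  have mono : ∀ S S' : Set (ℕ × ℕ), S ⊆ S' → ¬ HasCrossing (k + 1) S' →
      ¬ HasCrossing (k + 1) S := by
    rintro S S' hS hn ⟨C, hCS, hc⟩
    exact hn ⟨C, hCS.trans hS, hc⟩
  constructor
  · rintro ⟨S, hS, rfl⟩
    refine ⟨⟨Set.inter_subset_right, mono _ _ Set.inter_subset_left hS.prop.2⟩, ?_⟩
    rintro T' ⟨hT', hc⟩ hle
    have h1 : S ∪ T' ⊆ diagonals n := Set.union_subset hS.prop.1 (hT'.trans hsub)
    have h2 : (S ∪ T') ∩ shape k n = T' := by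
      rw [Set.union_inter_distrib_right, Set.inter_eq_left.mpr hT']
      exact Set.union_eq_right.mpr hle
    have h3 := hS.le_of_ge ⟨h1, key _ h1 (by rwa [h2])⟩ Set.subset_union_left
    exact fun d hd => ⟨h3 (Or.inr hd), hT' hd⟩
  · intro hT
    refine ⟨T ∪ (diagonals n \ shape k n), ⟨⟨?_, ?_⟩, ?_⟩, ?_⟩
    · exact Set.union_subset (hT.prop.1.trans hsub) Set.sdiff_subset
    · refine key _ (Set.union_subset (hT.prop.1.trans hsub) Set.sdiff_subset)
        (mono _ T ?_ hT.prop.2)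
      rintro d ⟨hd | hd, hd'⟩
      exacts [hd, absurd hd' hd.2]
    · rintro S' ⟨hS', hc⟩ hle d hd
      by_cases h : d ∈ shape k n
      · exact Or.inl (hT.le_of_ge ⟨Set.inter_subset_right, mono _ _ Set.inter_subset_left hc⟩
          (fun e he => ⟨hle (Or.inl he), hT.prop.1 he⟩) ⟨hd, h⟩)
      · exact Or.inr ⟨hS' hd, h⟩
    · ext d
      constructor
      · exact fun hd => ⟨Or.inl hd, hT.prop.1 hd⟩
      · rintro ⟨hd | hd, hd'⟩
        exacts [hd, absurd hd' hd.2]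

end KTri

/-!
A `k`-triangulation `T` with corner `r` contains a distinguished `k`-star: the star polygon with
vertices `a_1 < ⋯ < a_k = r < r + 1 < ⋯ < r + k + 1` and sides `(a_i, r + i)`, `(a_i, r + i + 1)`
and `(r + 1, r + k + 1)`. The parent operation *flattens* this star, identifying `(a_i, r + i)`
with `(a_i, r + i + 1)`; the images of these sides form a `k`-crossing. Conversely, the choice of
`u` and `b_1 < ⋯ < b_{k-1}` is the choice of a `k`-crossing `(b_i, u + i)`, `1 ≤ i ≤ k`, with
`b_k = u`, and the child operation *inflates* it to a star. To treat both operations uniformly, a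
star is encoded by a function `h` on columns (`IsStar`): in column `y`, the crosses in rows
`≥ h y` stay, and the others move by one column. Trivial diagonals count as present (`full`);
they are in no `(k + 1)`-crossing.

* The star exists (`right_side_mem`): the sides `(a_i, r + i)` are chosen greedily, and if
  `(a_i, r + i + 1)` were missing, then the `(k + 1)`-crossing that forbids it could be rerouted
  along the sides already found to a `(k + 1)`-crossing of `T`.
* Neither operation creates a `(k + 1)`-crossing (`HasCrossing.of_inflate`,
  `HasCrossing.of_flatten`). For inflating, a crossing of the larger diagram projects to the
  smaller one. For flattening, a crossing of the smaller diagram is lifted, with some of its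
  members replaced by sides of the star where two of them would end up in the same column.
* The operations are therefore mutually inverse and monotone between the sets without
  `(k + 1)`-crossing that contain the star, and those that contain the `k`-crossing, so that they
  preserve maximality (`flatten_mem`, `inflate_mem`). This uses that a set that contains the star
  but no `(k + 1)`-crossing has no cross between consecutive sides of the star
  (`HasCrossing.of_gap`), which also shows that the star at a given corner is unique
  (`cornerStar_unique`). No count of the diagonals of a `k`-triangulation is needed.
* Consequently `T` is determined by its parent and its star, and the children of a diagram
  correspond to the possible stars (`bijOn_child`). The generating tree is a tree because every
  diagram except `∅` has exactly one parent, one level closer to `∅` (`isTree_fromRel`).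
-/

namespace KTri

/-! ### Crossings -/

/-- `d` and `e` cross, and `d` starts first. -/
def Before (d e : ℕ × ℕ) : Prop :=
  d.1 < e.1 ∧ e.1 < d.2 ∧ d.2 < e.2

theorem Crosses.symm {d e : ℕ × ℕ} (h : Crosses d e) : Crosses e d := Or.symm h

/-- In a crossing, the column determines the diagonal. -/
theorem eq_of_snd_eq {C : Finset (ℕ × ℕ)} (hp : (C : Set (ℕ × ℕ)).Pairwise Crosses)
    {d e : ℕ × ℕ} (hd : d ∈ C) (he : e ∈ C) (h : d.2 = e.2) : d = e := by
  by_contra hne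
  have := hp hd he hne
  simp only [Crosses] at this
  omega

/-- In a crossing, the order of the columns is the order of the rows. -/
theorem before_of_snd_lt {C : Finset (ℕ × ℕ)} (hp : (C : Set (ℕ × ℕ)).Pairwise Crosses)
    {d e : ℕ × ℕ} (hd : d ∈ C) (he : e ∈ C) (h : d.2 < e.2) : Before d e := by
  have := hp hd he (by rintro rfl; omega)
  simp only [Crosses] at this
  simp only [Before]
  omega

theorem HasCrossing.mono {m : ℕ} {S S' : Set (ℕ × ℕ)} (h : HasCrossing m S) (hS : S ⊆ S') :
    HasCrossing m S' := by
  obtain ⟨C, hC, h⟩ := h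
  exact ⟨C, hC.trans hS, h⟩

/-- A map that respects `Before` carries a crossing to a crossing of the same size. -/
theorem HasCrossing.of_map {S : Set (ℕ × ℕ)} {C : Finset (ℕ × ℕ)}
    (hp : (C : Set (ℕ × ℕ)).Pairwise Crosses) (g : ℕ × ℕ → ℕ × ℕ) (hg : ∀ e ∈ C, g e ∈ S)
    (hlt : ∀ d ∈ C, ∀ e ∈ C, Before d e → Before (g d) (g e)) : HasCrossing C.card S := by
  have hcr : ∀ d ∈ C, ∀ e ∈ C, d ≠ e → Crosses (g d) (g e) := fun d hd e he hne =>
    (hp hd he hne).imp (hlt d hd e he) (hlt e he d hd)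
  refine ⟨C.image g, ?_, ?_, ?_⟩
  · intro x hx
    obtain ⟨e, he, rfl⟩ := Finset.mem_image.1 (Finset.mem_coe.1 hx)
    exact hg e he
  · refine Finset.card_image_of_injOn fun d hd e he hde => ?_
    by_contra hne
    have := hcr d hd e he hne
    simp only [Crosses, hde] at this
    omega
  · intro x hx y hy hne
    obtain ⟨d, hd, rfl⟩ := Finset.mem_image.1 (Finset.mem_coe.1 hx)
    obtain ⟨e, he, rfl⟩ := Finset.mem_image.1 (Finset.mem_coe.1 hy)
    exact hcr d hd e he fun h => hne (by rw [h])

/-- A sequence that increases with respect to `Before` is a crossing. -/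
theorem HasCrossing.of_seq {m : ℕ} {S : Set (ℕ × ℕ)} (f : ℕ → ℕ × ℕ) (hf : ∀ i < m, f i ∈ S)
    (hlt : ∀ i j, i < j → j < m → Before (f i) (f j)) : HasCrossing m S := by
  have hcr : ∀ i < m, ∀ j < m, i ≠ j → Crosses (f i) (f j) := fun i hi j hj hne =>
    (lt_or_gt_of_ne hne).imp (fun h => hlt i j h hj) (fun h => hlt j i h hi)
  refine ⟨(Finset.range m).image f, ?_, ?_, ?_⟩
  · intro x hx
    obtain ⟨i, hi, rfl⟩ := Finset.mem_image.1 (Finset.mem_coe.1 hx)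
    exact hf i (Finset.mem_range.1 hi)
  · rw [Finset.card_image_of_injOn, Finset.card_range]
    intro i hi j hj hij
    by_contra hne
    have := hcr i (Finset.mem_range.1 (Finset.mem_coe.1 hi)) j
      (Finset.mem_range.1 (Finset.mem_coe.1 hj)) hne
    simp only [Crosses, hij] at this
    omega
  · intro x hx y hy hne
    obtain ⟨i, hi, rfl⟩ := Finset.mem_image.1 (Finset.mem_coe.1 hx)
    obtain ⟨j, hj, rfl⟩ := Finset.mem_image.1 (Finset.mem_coe.1 hy)
    exact hcr i (Finset.mem_range.1 hi) j (Finset.mem_range.1 hj) fun h => hne (by rw [h])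

theorem HasCrossing.insert {m : ℕ} {S : Set (ℕ × ℕ)} {d : ℕ × ℕ} {C : Finset (ℕ × ℕ)}
    (hC : (C : Set (ℕ × ℕ)) ⊆ S) (hcard : C.card = m)
    (hp : (C : Set (ℕ × ℕ)).Pairwise Crosses) (hd : ∀ e ∈ C, Crosses d e) :
    HasCrossing (m + 1) (insert d S) := by
  have hdC : d ∉ C := fun h => by
    have := hd d h
    simp only [Crosses] at this
    omega
  refine ⟨Insert.insert d C, ?_, by rw [Finset.card_insert_of_notMem hdC, hcard], ?_⟩
  · rw [Finset.coe_insert]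
    exact Set.insert_subset_insert hC
  · rw [Finset.coe_insert]
    exact hp.insert fun e he _ => ⟨hd e he, (hd e he).symm⟩

/-! ### Diagrams completed by the trivial diagonals -/

/-- The set of diagonals represented by the diagram `T`: the trivial diagonals are added back. -/
def full (k n : ℕ) (T : Set (ℕ × ℕ)) : Set (ℕ × ℕ) :=
  T ∪ (diagonals n \ shape k n)

theorem subset_full {k n : ℕ} {T : Set (ℕ × ℕ)} : T ⊆ full k n T := Set.subset_union_left

theorem shape_subset_diagonals {k n : ℕ} (hk : 1 ≤ k) : shape k n ⊆ diagonals n := by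
  rintro ⟨a, b⟩ h
  simp only [shape, diagonals, Set.mem_ofPred_eq, ne_eq, Prod.mk.injEq] at h ⊢
  omega

theorem full_subset_diagonals {k n : ℕ} (hk : 1 ≤ k) {T : Set (ℕ × ℕ)} (hT : T ⊆ shape k n) :
    full k n T ⊆ diagonals n :=
  Set.union_subset (hT.trans (shape_subset_diagonals hk)) Set.sdiff_subset

theorem mem_of_mem_full {k n : ℕ} {T : Set (ℕ × ℕ)} {d : ℕ × ℕ} (h : d ∈ full k n T)
    (hd : d ∈ shape k n) : d ∈ T :=
  h.resolve_right fun h' => h'.2 hd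

theorem mem_full_of_imp {k n : ℕ} {T : Set (ℕ × ℕ)} {d : ℕ × ℕ} (hd : d ∈ diagonals n)
    (h : d ∈ shape k n → d ∈ T) : d ∈ full k n T := by
  by_cases hs : d ∈ shape k n
  · exact Or.inl (h hs)
  · exact Or.inr ⟨hd, hs⟩

theorem full_mono {k n : ℕ} {T T' : Set (ℕ × ℕ)} (h : T ⊆ T') : full k n T ⊆ full k n T' :=
  Set.union_subset_union_left _ h

/-- The trivial diagonals create no `(k + 1)`-crossing. -/
theorem HasCrossing.of_full {k n : ℕ} (hk : 1 ≤ k) {T : Set (ℕ × ℕ)} (hT : T ⊆ shape k n)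
    (h : HasCrossing (k + 1) (full k n T)) : HasCrossing (k + 1) T := by
  obtain ⟨C, hC, hcard, hp⟩ := h
  exact ⟨C, fun d hd => mem_of_mem_full (hC hd)
    (not_mem_crossing (hC.trans (full_subset_diagonals hk hT)) hcard hp hd), hcard, hp⟩

/-! ### Maximality -/

theorem subset_shape {k n : ℕ} (hk : 1 ≤ k) {T : Set (ℕ × ℕ)} (hT : T ∈ kTriangulations k n) :
    T ⊆ shape k n := ((mem_kTriangulations_iff hk).1 hT).prop.1

theorem not_hasCrossing_full {k n : ℕ} (hk : 1 ≤ k) {T : Set (ℕ × ℕ)}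
    (hT : T ∈ kTriangulations k n) : ¬ HasCrossing (k + 1) (full k n T) := fun h =>
  ((mem_kTriangulations_iff hk).1 hT).prop.2 (h.of_full hk (subset_shape hk hT))

theorem eq_of_subset {k n : ℕ} (hk : 1 ≤ k) {T T' : Set (ℕ × ℕ)}
    (hT : T ∈ kTriangulations k n) (hle : T ⊆ T') (hT' : T' ⊆ shape k n)
    (h : ¬ HasCrossing (k + 1) T') : T' = T :=
  (((mem_kTriangulations_iff hk).1 hT).eq_of_le ⟨hT', h⟩ hle).symm

theorem mem_kTriangulations_of_insert {k n : ℕ} (hk : 1 ≤ k) {T : Set (ℕ × ℕ)}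
    (hT : T ⊆ shape k n) (hfree : ¬ HasCrossing (k + 1) T)
    (h : ∀ d ∈ shape k n, ¬ HasCrossing (k + 1) (insert d T) → d ∈ T) :
    T ∈ kTriangulations k n := by
  rw [mem_kTriangulations_iff hk]
  refine ⟨⟨hT, hfree⟩, fun T' hT' hle d hd => h d (hT'.1 hd) fun hc => hT'.2 (hc.mono ?_)⟩
  exact Set.insert_subset hd hle

/-- A nontrivial diagonal missing in a `k`-triangulation crosses all members of a
`k`-crossing. -/
theorem exists_crossing_of_notMem {k n : ℕ} (hk : 1 ≤ k) {T : Set (ℕ × ℕ)}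
    (hT : T ∈ kTriangulations k n) {d : ℕ × ℕ} (hd : d ∈ shape k n) (hdT : d ∉ T) :
    ∃ C : Finset (ℕ × ℕ), (C : Set (ℕ × ℕ)) ⊆ T ∧ C.card = k ∧
      (C : Set (ℕ × ℕ)).Pairwise Crosses ∧ ∀ e ∈ C, Crosses d e := by
  have hc : HasCrossing (k + 1) (insert d T) := by
    by_contra hc
    have := eq_of_subset hk hT (Set.subset_insert d T)
      (Set.insert_subset hd (subset_shape hk hT)) hc
    exact hdT (this ▸ Set.mem_insert d T)
  obtain ⟨C, hC, hcard, hp⟩ := hc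
  have hdC : d ∈ C := by
    by_contra hdC
    refine ((mem_kTriangulations_iff hk).1 hT).prop.2 ⟨C, fun e he => ?_, hcard, hp⟩
    exact (hC he).resolve_left fun h => hdC (h ▸ he)
  refine ⟨C.erase d, fun e he => ?_, by rw [Finset.card_erase_of_mem hdC, hcard]; rfl,
    hp.mono (by simp), fun e he => ?_⟩
  · have he' := Finset.mem_erase.1 (Finset.mem_coe.1 he)
    exact (hC he'.2).resolve_left he'.1
  · have he' := Finset.mem_erase.1 he
    exact hp hdC he'.2 he'.1.symm

section

/-! ### Stars, flattening and inflating -/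

/-- A `k`-star with vertices `a_1 < ⋯ < a_k = u < u + 1 < ⋯ < u + k + 1`, encoded by a function
`h` on columns: `h (u + i) = a_i` for `1 ≤ i ≤ k`, continued by `0` to the left and by
`h y = y - k` to the right. The sides of the star are `(h y, y)` and `(h y, y + 1)` for
`u < y ≤ u + k`, together with `(u + 1, u + k + 1)`. -/
structure IsStar (k u : ℕ) (h : ℕ → ℕ) : Prop where
  eq_zero : ∀ y ≤ u, h y = 0
  lt_succ : ∀ y, u ≤ y → h y < h (y + 1)
  add_eq : ∀ y, u + k ≤ y → h y + k = y

variable {k u : ℕ} {h : ℕ → ℕ}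

namespace IsStar

theorem lt (H : IsStar k u h) {y z : ℕ} (hy : u ≤ y) (hyz : y < z) : h y < h z := by
  induction z, hyz using Nat.le_induction with
  | base => exact H.lt_succ y hy
  | succ z hz ih => exact ih.trans (H.lt_succ z (by omega))

theorem mono (H : IsStar k u h) {y z : ℕ} (hyz : y ≤ z) : h y ≤ h z := by
  rcases hyz.eq_or_lt with rfl | hlt
  · exact le_rfl
  rcases le_total y u with hy | hy
  · rw [H.eq_zero y hy]; exact Nat.zero_le _
  · exact (H.lt hy hlt).le

theorem add_gap_le (H : IsStar k u h) {y : ℕ} (hy : u ≤ y) (j : ℕ) : h y + j ≤ h (y + j) := by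
  induction j with
  | zero => exact le_rfl
  | succ j ih =>
    have := H.lt_succ (y + j) (by omega)
    rw [← add_assoc y j 1]
    omega

theorem gap_le (H : IsStar k u h) {y z : ℕ} (hy : u ≤ y) (hyz : y ≤ z) :
    h y + (z - y) ≤ h z := by
  have := H.add_gap_le hy (z - y)
  rwa [Nat.add_sub_cancel' hyz] at this

theorem add_le (H : IsStar k u h) {y : ℕ} (hy : u < y) : h y + k ≤ y := by
  rcases le_total (u + k) y with h1 | h1
  · exact (H.add_eq y h1).le
  · have h2 := H.gap_le hy.le h1
    have h3 := H.add_eq (u + k) le_rfl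
    omega

theorem le_add (H : IsStar k u h) {y : ℕ} (hy : u ≤ y) : y ≤ h y + u := by
  have := H.gap_le le_rfl hy
  omega

theorem lt_of_pos (H : IsStar k u h) {x y : ℕ} (hx : x < h y) : u < y := by
  by_contra hy
  rw [H.eq_zero y (by omega)] at hx
  omega

theorem le_of_le (H : IsStar k u h) {y : ℕ} (hy : y ≤ u + k) : h y ≤ u := by
  have h1 := H.mono hy
  have h2 := H.add_eq (u + k) le_rfl
  omega

theorem le_of_row_le (H : IsStar k u h) {y : ℕ} (hy : h y ≤ u) : y ≤ u + k := by
  by_contra hlt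
  have := H.add_eq y (by omega)
  omega

end IsStar

/-- Flattening along the star `h`: in every column, the crosses below the star stay, and those
above it move one column to the left. -/
def flatten (h : ℕ → ℕ) (F : Set (ℕ × ℕ)) : Set (ℕ × ℕ) :=
  {p | (h p.2 ≤ p.1 ∧ p ∈ F) ∨ (p.1 < h p.2 ∧ (p.1, p.2 + 1) ∈ F)}

/-- Inflating along `h`: in every column, the crosses in rows `≥ h y` stay, those in rows `< h y`
move one column to the right, and the squares `(h y, y + 1)`, `u < y ≤ u + k`, are added. -/
def inflate (k u : ℕ) (h : ℕ → ℕ) (G : Set (ℕ × ℕ)) : Set (ℕ × ℕ) :=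
  {p | (h p.2 ≤ p.1 ∧ p ∈ G) ∨
    ∃ y, p.2 = y + 1 ∧ ((p.1 < h y ∧ (p.1, y) ∈ G) ∨ (p.1 = h y ∧ u < y ∧ y ≤ u + k))}

theorem mem_flatten {F : Set (ℕ × ℕ)} {x y : ℕ} :
    (x, y) ∈ flatten h F ↔ (h y ≤ x ∧ (x, y) ∈ F) ∨ (x < h y ∧ (x, y + 1) ∈ F) := Iff.rfl

theorem mem_inflate {G : Set (ℕ × ℕ)} {x y : ℕ} :
    (x, y) ∈ inflate k u h G ↔ (h y ≤ x ∧ (x, y) ∈ G) ∨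
      ∃ z, y = z + 1 ∧ ((x < h z ∧ (x, z) ∈ G) ∨ (x = h z ∧ u < z ∧ z ≤ u + k)) := Iff.rfl

theorem flatten_mono {F F' : Set (ℕ × ℕ)} (hF : F ⊆ F') : flatten h F ⊆ flatten h F' :=
  fun _ hp => hp.imp (fun h => ⟨h.1, hF h.2⟩) fun h => ⟨h.1, hF h.2⟩

theorem inflate_mono {G G' : Set (ℕ × ℕ)} (hG : G ⊆ G') :
    inflate k u h G ⊆ inflate k u h G' :=
  fun _ hp => hp.imp (fun h => ⟨h.1, hG h.2⟩) fun ⟨y, hy, h⟩ =>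
    ⟨y, hy, h.imp (fun h => ⟨h.1, hG h.2⟩) id⟩

/-- Inflating creates no crossing: moving every inflated cross back preserves `Before`. -/
theorem HasCrossing.of_inflate (H : IsStar k u h) {G S : Set (ℕ × ℕ)} {m : ℕ}
    (hG : ∀ y, u < y → y ≤ u + k → (h y, y) ∈ G) (hS : S ⊆ inflate k u h G)
    (hrow : ∀ e ∈ S, e.1 ≤ u) (hc : HasCrossing m S) : HasCrossing m G := by
  obtain ⟨C, hC, rfl, hp⟩ := hc
  refine HasCrossing.of_map hp (fun e => if h e.2 ≤ e.1 then e else (e.1, e.2 - 1)) ?_ ?_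
  · rintro ⟨x, y⟩ he
    rcases mem_inflate.1 (hS (hC he)) with ⟨h1, h2⟩ | ⟨z, rfl, ⟨h1, h2⟩ | ⟨h1, h2, h3⟩⟩
    · simpa [h1] using h2
    · have := H.mono (Nat.le_succ z)
      simp only [Nat.succ_eq_add_one] at this
      rw [if_neg (by simp only; omega)]
      simpa using h2
    · have := H.lt_succ z h2.le
      rw [if_neg (by simp only; omega)]
      simpa [h1] using hG z h2 h3
  · rintro ⟨x, y⟩ he ⟨x', y'⟩ he' hlt
    have hx' := hrow _ (hC he')
    simp only [Before] at hlt hx' ⊢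
    obtain ⟨h1, h2, h3⟩ := hlt
    by_cases c : h y ≤ x <;> by_cases c' : h y' ≤ x'
    · simp only [c, c', if_true]
      exact ⟨h1, h2, h3⟩
    · simp only [c, c', if_true, if_false]
      refine ⟨h1, h2, ?_⟩
      by_contra h4
      obtain rfl : y' = y + 1 := by omega
      rcases mem_inflate.1 (hS (hC he')) with ⟨h5, h6⟩ | ⟨z, hz, ⟨h5, h6⟩ | ⟨h5, h6⟩⟩
      · exact c' h5
      · obtain rfl : y = z := by omega
        omega
      · obtain rfl : y = z := by omega
        omega
    · simp only [c, c', if_true, if_false]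
      refine ⟨h1, ?_, by omega⟩
      rcases mem_inflate.1 (hS (hC he)) with ⟨h5, h6⟩ | ⟨z, rfl, ⟨h5, h6⟩ | ⟨h5, h6⟩⟩
      · exact absurd h5 c
      · have := H.lt_of_pos h5
        omega
      · omega
    · simp only [c, c', if_false]
      refine ⟨h1, ?_, by omega⟩
      rcases mem_inflate.1 (hS (hC he)) with ⟨h5, h6⟩ | ⟨z, rfl, ⟨h5, h6⟩ | ⟨h5, h6⟩⟩
      · exact absurd h5 c
      · have := H.lt_of_pos h5
        omega
      · omega

/-- The column `z` starts a run of columns of `C` in which the crosses lie above the star `h`,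
and which ends at a column whose cross does not. The crosses of such a run cannot be moved to the
right when lifting a crossing from the flattened diagram. -/
def Blocked (C : Finset (ℕ × ℕ)) (u : ℕ) (h : ℕ → ℕ) (z : ℕ) : Prop :=
  u < z ∧ ∃ j, z < j ∧ (∀ i, z ≤ i → i < j → ∃ x, (x, i) ∈ C ∧ x < h i) ∧
    ∃ x, (x, j) ∈ C ∧ h j ≤ x

open Classical in
/-- Flattening along a star of `F` creates no crossing. A crossing is lifted by leaving the crosses
below the star, moving those above it to the right, and replacing those of a blocked column by
the side of the star in the same column. -/
theorem HasCrossing.of_flatten (H : IsStar k u h) {F S : Set (ℕ × ℕ)} {m : ℕ}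
    (hF : ∀ y, u < y → y ≤ u + k → (h y, y) ∈ F) (hS : S ⊆ flatten h F)
    (hrow : ∀ e ∈ S, e.1 ≤ u) (hc : HasCrossing m S) : HasCrossing m F := by
  obtain ⟨C, hC, rfl, hp⟩ := hc
  have uniq : ∀ {x x' y : ℕ}, (x, y) ∈ C → (x', y) ∈ C → x = x' := fun h1 h2 =>
    congrArg Prod.fst (eq_of_snd_eq hp h1 h2 rfl)
  -- the side in a blocked column lies above the crosses further right that are not replaced,
  -- because the cross that ends the run does not lie above the star
  have below : ∀ {z x' z' : ℕ}, Blocked C u h z → (x', z') ∈ C → z < z' →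
      (h z' ≤ x' ∨ ¬ Blocked C u h z') → h z < x' := by
    rintro z x' z' ⟨hz, j, hj, hrun, x, hx, hjx⟩ he' hlt hcase
    have hzj := H.lt hz.le hj
    rcases lt_trichotomy z' j with h1 | rfl | h1
    · exfalso
      obtain ⟨x'', hx'', h2⟩ := hrun z' hlt.le h1
      obtain rfl := uniq hx'' he'
      refine hcase.resolve_left (by omega)
        ⟨by omega, j, h1, fun i hi => hrun i (by omega), x, hx, hjx⟩
    · obtain rfl := uniq hx he'
      omega
    · have := (before_of_snd_lt hp hx he' h1).1
      simp only at this
      omega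
  -- the side that replaces a cross still starts before the end of the earlier diagonals, since it
  -- starts before the cross that ends the run
  have above : ∀ {x z z' : ℕ}, Blocked C u h z' → (x, z) ∈ C → z < z' → h z' < z := by
    rintro x z z' ⟨hz, j, hj, hrun, x', hx', hjx⟩ he hlt
    have hzj := H.lt hz.le hj
    have := (before_of_snd_lt hp he hx' (hlt.trans hj)).2.1
    simp only at this
    omega
  -- a cross that would be moved into the column of a cross that is not moved is itself replaced
  have step : ∀ {x z x' : ℕ}, (x, z) ∈ C → x < h z → (x', z + 1) ∈ C →
      (h (z + 1) ≤ x' ∨ Blocked C u h (z + 1)) → Blocked C u h z := by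
    intro x z x' he hx he' hcase
    refine ⟨H.lt_of_pos hx, ?_⟩
    rcases hcase with h1 | ⟨-, j, hj, hrun, hend⟩
    · refine ⟨z + 1, by omega, fun i hi hi' => ?_, x', he', h1⟩
      obtain rfl : i = z := by omega
      exact ⟨x, he, hx⟩
    · refine ⟨j, by omega, fun i hi hi' => ?_, hend⟩
      rcases hi.eq_or_lt with rfl | h2
      · exact ⟨x, he, hx⟩
      · exact hrun i h2 hi'
  refine HasCrossing.of_map hp (fun e => if h e.2 ≤ e.1 then e else
    if Blocked C u h e.2 then (h e.2, e.2) else (e.1, e.2 + 1)) ?_ ?_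
  · rintro ⟨x, y⟩ he
    simp only
    split_ifs with h1 h2
    · exact ((mem_flatten.1 (hS (hC he))).resolve_right fun h => by omega).2
    · obtain ⟨hy, j, hj, -, x', hx', hjx⟩ := h2
      have h3 := hrow _ (hC hx')
      have h4 := H.le_of_row_le (hjx.trans h3)
      exact hF y hy (by omega)
    · exact ((mem_flatten.1 (hS (hC he))).resolve_left fun h => by omega).2
  · rintro ⟨x, y⟩ he ⟨x', y'⟩ he' hlt
    have hx := hrow _ (hC he)
    have hx' := hrow _ (hC he')
    simp only [Before] at hlt hx hx' ⊢
    obtain ⟨h1, h2, h3⟩ := hlt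
    by_cases c : h y ≤ x <;> by_cases c' : h y' ≤ x' <;> by_cases b : Blocked C u h y <;>
      by_cases b' : Blocked C u h y' <;> simp only [c, c', b, b', if_true, if_false]
    all_goals try have i1 := below b he' h3 (Or.inl c')
    all_goals try have i2 := below b he' h3 (Or.inr b')
    all_goals try have i3 := above b' he h3
    all_goals try have i4 := H.lt b.1.le h3
    all_goals
      refine ⟨by omega, by omega, ?_⟩
      first
      | omega
      | by_contra h4
        obtain rfl : y' = y + 1 := by omega
        first
        | exact b (step he (by omega) he' (Or.inl c'))
        | exact b (step he (by omega) he' (Or.inr b'))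

end

section

variable {k u : ℕ} {h : ℕ → ℕ}

/-- `F` contains the sides of the star `h` (the boundary edge `(u + 1, u + k + 1)` excepted). -/
def HasSides (k u : ℕ) (h : ℕ → ℕ) (F : Set (ℕ × ℕ)) : Prop :=
  ∀ y, u < y → y ≤ u + k → (h y, y) ∈ F ∧ (h y, y + 1) ∈ F

/-- A cross strictly between two consecutive sides `(h z, z + 1)` and `(h (z + 1), z + 1)` of a
star completes `k` of the sides to a `(k + 1)`-crossing. -/
theorem HasCrossing.of_gap (H : IsStar k u h) {F : Set (ℕ × ℕ)} (hF : HasSides k u h F)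
    {x z : ℕ} (hx : (x, z + 1) ∈ F) (hz : u ≤ z) (hz' : z ≤ u + k) (h1 : h z < x)
    (h2 : x < h (z + 1)) : HasCrossing (k + 1) F := by
  have hxu : x ≤ u := by
    have h3 := H.mono (show z + 1 ≤ u + k + 1 by omega)
    have h4 := H.add_eq (u + k + 1) (by omega)
    omega
  refine HasCrossing.of_seq (fun i => if u + i < z then (h (u + 1 + i), u + 1 + i) else
    if u + i = z then (x, z + 1) else (h (u + i), u + i + 1)) ?_ ?_
  · intro i hi
    split_ifs
    · exact (hF _ (by omega) (by omega)).1
    · exact hx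
    · exact (hF _ (by omega) (by omega)).2
  · intro i j hij hj
    have hle : ∀ w, w ≤ u + k → h w ≤ u := fun w => H.le_of_le
    have hlt : ∀ v w, u ≤ v → v < w → h v < h w := fun v w => H.lt
    have hmono : ∀ v w, v ≤ w → h v ≤ h w := fun v w => H.mono
    simp only [Before]
    split_ifs
    · exact ⟨hlt _ _ (by omega) (by omega),
        by have := hle (u + 1 + j) (by omega); simp only; omega, by simp only; omega⟩
    · exact ⟨by have := hmono (u + 1 + i) z (by omega); simp only; omega, by simp only; omega,
        by simp only; omega⟩
    · exact ⟨hlt _ _ (by omega) (by omega),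
        by have := hle (u + j) (by omega); simp only; omega, by simp only; omega⟩
    all_goals try omega
    · exact ⟨by have := hmono (z + 1) (u + j) (by omega); simp only; omega,
        by have := hle (u + j) (by omega); simp only; omega, by simp only; omega⟩
    · exact ⟨hlt _ _ (by omega) (by omega),
        by have := hle (u + j) (by omega); simp only; omega, by simp only; omega⟩

/-- A nontrivial diagonal starting at `u + 1` crosses `k` sides of the star. -/
theorem HasCrossing.of_row_succ (H : IsStar k u h) {F : Set (ℕ × ℕ)} (hF : HasSides k u h F)
    {y : ℕ} (hy : (u + 1, y) ∈ F) (hlen : u + 1 + k < y) : HasCrossing (k + 1) F := by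
  refine HasCrossing.of_seq (fun i => if i < k then (h (u + 1 + i), u + 1 + i + 1) else
    (u + 1, y)) ?_ ?_
  · intro i hi
    split_ifs
    · exact (hF _ (by omega) (by omega)).2
    · exact hy
  · intro i j hij hj
    simp only [Before]
    rw [if_pos (by omega : i < k)]
    have := H.le_of_le (show u + 1 + i ≤ u + k by omega)
    split_ifs
    · have := H.le_of_le (show u + 1 + j ≤ u + k by omega)
      exact ⟨H.lt (by omega) (by omega), by simp only; omega, by simp only; omega⟩
    · exact ⟨by simp only; omega, by simp only; omega, by simp only; omega⟩

/-! ### Flattening preserves maximality -/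

section
variable {n : ℕ}

theorem flatten_subset_full (hk : 2 ≤ k) (H : IsStar k u h) {T : Set (ℕ × ℕ)}
    (hT : T ⊆ shape k (n + 1)) (hrow : ∀ d ∈ T, d.1 ≤ u) (hun : u + k ≤ n) :
    flatten h T ⊆ full k n (flatten h T ∩ shape k n) := by
  rintro ⟨x, y⟩ hp
  refine mem_full_of_imp ?_ fun hs => ⟨hp, hs⟩
  rcases mem_flatten.1 hp with ⟨h1, h2⟩ | ⟨h1, h2⟩
  · have h3 := hT h2
    have h4 := hrow _ h2
    have h5 := H.le_of_row_le (h1.trans h4)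
    simp only [shape, diagonals, Set.mem_ofPred_eq, ne_eq, Prod.mk.injEq] at *
    omega
  · have h3 := hT h2
    have := H.add_le (H.lt_of_pos h1)
    simp only [shape, diagonals, Set.mem_ofPred_eq, ne_eq, Prod.mk.injEq] at *
    omega

/-- After flattening, the two sides of the star in each row are merged into `(h y, y)`. -/
theorem side_mem_full_flatten (H : IsStar k u h) {T : Set (ℕ × ℕ)} (hk : 2 ≤ k)
    (hun : u + k ≤ n) (hs : HasSides k u h (full k (n + 1) T)) :
    ∀ y, u < y → y ≤ u + k → (h y, y) ∈ full k n (flatten h T ∩ shape k n) := by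
  intro y h1 h2
  have h3 := H.add_le h1
  have h4 := H.le_add h1.le
  refine mem_full_of_imp ?_ fun hsh => ⟨Or.inl ⟨le_rfl, mem_of_mem_full (hs y h1 h2).1 ?_⟩, hsh⟩
  · simp only [diagonals, Set.mem_ofPred_eq, ne_eq, Prod.mk.injEq] at *
    omega
  · simp only [shape, Set.mem_ofPred_eq] at *
    omega

theorem inflate_full_row_le (H : IsStar k u h) {P : Set (ℕ × ℕ)}
    (hrow : ∀ d ∈ P, d.1 ≤ u) {d : ℕ × ℕ} (hd : d ∈ inflate k u h (full k n P))
    (hs : d ∈ shape k (n + 1)) : d.1 ≤ u := by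
  obtain ⟨x, y⟩ := d
  by_contra hx
  have key : ∀ y, (x, y) ∈ full k n P → ¬ (x, y) ∈ shape k n := fun y h1 h2 =>
    hx (hrow (x, y) (mem_of_mem_full h1 h2))
  rcases mem_inflate.1 hd with ⟨h1, h2⟩ | ⟨z, rfl, ⟨h1, h2⟩ | ⟨h1, h2, h3⟩⟩
  · rcases le_total (u + k) y with h3 | h3
    · have := H.add_eq y h3
      simp only [shape, Set.mem_ofPred_eq] at *
      omega
    · simp only [shape, Set.mem_ofPred_eq] at *
      omega
  · have h3 := H.add_le (H.lt_of_pos h1)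
    have h4 := key _ h2
    simp only [shape, Set.mem_ofPred_eq] at *
    omega
  · have := H.le_of_le h3
    simp only at hx
    omega

/-- Inflating undoes flattening. -/
theorem subset_inflate_flatten (H : IsStar k u h) {T : Set (ℕ × ℕ)}
    (hT : T ⊆ shape k (n + 1)) (hrow : ∀ d ∈ T, d.1 ≤ u)
    (hk : 2 ≤ k) (hun : u + k ≤ n)
    (hs : HasSides k u h (full k (n + 1) T)) (hfree : ¬ HasCrossing (k + 1) (full k (n + 1) T)) :
    T ⊆ inflate k u h (full k n (flatten h T ∩ shape k n)) := by
  rintro ⟨x, y⟩ hd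
  have hx := hrow _ hd
  simp only at hx
  by_cases h1 : h y ≤ x
  · exact Or.inl ⟨h1, flatten_subset_full hk H hT hrow hun (Or.inl ⟨h1, hd⟩)⟩
  · push Not at h1
    have hy := H.lt_of_pos h1
    obtain ⟨z, rfl⟩ : ∃ z, y = z + 1 := ⟨y - 1, by omega⟩
    refine Or.inr ⟨z, rfl, ?_⟩
    rcases lt_trichotomy x (h z) with h2 | h2 | h2
    · exact Or.inl ⟨h2, flatten_subset_full hk H hT hrow hun (Or.inr ⟨h2, hd⟩)⟩
    · have h3 := hT hd
      refine Or.inr ⟨h2, ?_, H.le_of_row_le (by omega)⟩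
      by_contra h4
      have := H.eq_zero z (by omega)
      simp only [shape, Set.mem_ofPred_eq] at h3
      omega
    · exact absurd (HasCrossing.of_gap H hs (subset_full hd) (by omega)
        (H.le_of_row_le (by omega)) h2 h1) hfree

theorem flatten_row_le {T : Set (ℕ × ℕ)} (hrow : ∀ d ∈ T, d.1 ≤ u) :
    ∀ d ∈ flatten h T, d.1 ≤ u := by
  rintro ⟨x, y⟩ (hd | hd)
  · exact hrow (x, y) hd.2
  · exact hrow (x, y + 1) hd.2

/-- Flattening a `k`-triangulation along a star gives a `k`-triangulation. A diagonal that starts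
in a row `≤ u` and could be added would survive inflating; one that starts below row `u` crosses
all members of a `k`-crossing obtained by moving a `k`-crossing of the larger polygon to the
left. -/
theorem flatten_mem (hk : 2 ≤ k) (H : IsStar k u h) (hku : k ≤ u) (hun : u + k ≤ n)
    {T : Set (ℕ × ℕ)} (hT : T ∈ kTriangulations k (n + 1)) (hrow : ∀ d ∈ T, d.1 ≤ u)
    (hs : HasSides k u h (full k (n + 1) T)) :
    flatten h T ∩ shape k n ∈ kTriangulations k n := by
  have hk1 : 1 ≤ k := by omega
  have hTs := subset_shape hk1 hT
  have hfree := not_hasCrossing_full hk1 hT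
  have hside := side_mem_full_flatten H hk hun hs
  have hrowP : ∀ d ∈ flatten h T ∩ shape k n, d.1 ≤ u := fun d hd => flatten_row_le hrow d hd.1
  refine mem_kTriangulations_of_insert hk1 Set.inter_subset_right ?_ ?_
  · intro hc
    exact hfree (HasCrossing.of_flatten H (fun y h1 h2 => (hs y h1 h2).1)
      (Set.inter_subset_left.trans (flatten_mono subset_full)) hrowP hc)
  · rintro ⟨x, y⟩ hd hc
    rcases lt_or_ge u x with hx | hx
    · exfalso
      have hd' : (x + 1, x + k + 2) ∈ shape k (n + 1) := by
        simp only [shape, Set.mem_ofPred_eq] at *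
        omega
      obtain ⟨C, hC, hcard, hp, hcr⟩ := exists_crossing_of_notMem hk1 hT hd'
        fun h => by have := hrow _ h; simp only at this; omega
      -- the members of `C` end in the columns `x + 2, …, x + k + 1`, to the right of the corner
      have hcol : ∀ e ∈ C, e.1 ≤ u ∧ x + 1 < e.2 ∧ e.2 < x + k + 2 := fun e he => by
        have h1 := hrow _ (hC he)
        have h2 := hcr e he
        simp only [Crosses] at h2
        omega
      set g : ℕ × ℕ → ℕ × ℕ := fun e => (min e.1 (h (e.2 - 1)), e.2 - 1) with hg
      have hlt : ∀ d ∈ C, ∀ e ∈ C, Before d e → Before (g d) (g e) := by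
        intro d hd e he hde
        have h1 := hcol d hd
        have h2 := hcol e he
        simp only [Before, hg] at *
        have := H.lt (y := d.2 - 1) (z := e.2 - 1) (by omega) (by omega)
        omega
      have hmem : ∀ e ∈ C, g e ∈ full k n (flatten h T ∩ shape k n) := by
        rintro ⟨e, z⟩ he
        have h1 := hcol _ he
        obtain ⟨w, rfl⟩ : ∃ w, z = w + 1 := ⟨z - 1, by simp only at h1; omega⟩
        simp only [hg, Nat.add_sub_cancel] at *
        rcases lt_or_ge e (h w) with h2 | h2
        · rw [min_eq_left h2.le]
          exact flatten_subset_full hk H hTs hrow hun (Or.inr ⟨h2, hC he⟩)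
        · rw [min_eq_right h2]
          exact hside w (by omega) (H.le_of_row_le (by omega))
      refine hc ?_
      obtain ⟨C', hC', hcard', hp'⟩ := HasCrossing.of_map (S := g '' C) hp g
        (fun e he => Set.mem_image_of_mem g he) hlt
      refine HasCrossing.of_full hk1 (Set.insert_subset hd Set.inter_subset_right)
        (HasCrossing.mono (HasCrossing.insert (d := (x, y)) hC' (hcard'.trans hcard) hp' ?_) ?_)
      · intro e he
        obtain ⟨e, he', rfl⟩ := hC' he
        have h1 := hcol e he'
        simp only [shape, Set.mem_ofPred_eq] at hd
        simp only [Crosses, hg]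
        omega
      · refine Set.insert_subset (subset_full (Set.mem_insert _ _)) ?_
        rintro _ ⟨e, he, rfl⟩
        exact full_mono (Set.subset_insert _ _) (hmem e he)
    · have hrow' : ∀ d ∈ insert (x, y) (flatten h T ∩ shape k n), d.1 ≤ u := by
        rintro d (rfl | hd)
        exacts [hx, hrowP d hd]
      have hW : inflate k u h (full k n (insert (x, y) (flatten h T ∩ shape k n))) ∩
          shape k (n + 1) = T := by
        refine eq_of_subset hk1 hT (fun d hd => ⟨inflate_mono (full_mono (Set.subset_insert _ _))
          (subset_inflate_flatten H hTs hrow hk hun hs hfree hd), hTs hd⟩)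
          Set.inter_subset_right fun hc' => hc ?_
        refine HasCrossing.of_full hk1 (Set.insert_subset hd Set.inter_subset_right)
          (HasCrossing.of_inflate H (fun z h1 h2 => full_mono (Set.subset_insert _ _)
            (hside z h1 h2)) Set.inter_subset_left ?_ hc')
        exact fun e he => inflate_full_row_le H hrow' he.1 he.2
      refine ⟨?_, hd⟩
      rcases le_or_gt (h y) x with h1 | h1
      · refine Or.inl ⟨h1, hW ▸ ⟨Or.inl ⟨h1, subset_full (Set.mem_insert _ _)⟩, ?_⟩⟩
        simp only [shape, Set.mem_ofPred_eq] at *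
        omega
      · refine Or.inr ⟨h1, hW ▸ ⟨Or.inr ⟨y, rfl, Or.inl ⟨h1, subset_full
          (Set.mem_insert _ _)⟩⟩, ?_⟩⟩
        simp only [shape, Set.mem_ofPred_eq] at *
        omega

/-! ### Inflating preserves maximality -/

theorem hasSides_inflate (H : IsStar k u h) (hk : 2 ≤ k) (hun : u + k ≤ n)
    {P : Set (ℕ × ℕ)} (hside : ∀ y, u < y → y ≤ u + k → (h y, y) ∈ full k n P) :
    HasSides k u h (full k (n + 1) (inflate k u h (full k n P) ∩ shape k (n + 1))) := by
  intro y h1 h2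
  have h3 := H.add_le h1
  have h4 := H.le_add h1.le
  have h5 := H.le_of_le h2
  constructor
  · refine mem_full_of_imp ?_ fun hs => ⟨Or.inl ⟨le_rfl, hside y h1 h2⟩, hs⟩
    simp only [diagonals, Set.mem_ofPred_eq, ne_eq, Prod.mk.injEq]
    omega
  · refine mem_full_of_imp ?_ fun hs => ⟨Or.inr ⟨y, rfl, Or.inr ⟨rfl, h1, h2⟩⟩, hs⟩
    simp only [diagonals, Set.mem_ofPred_eq, ne_eq, Prod.mk.injEq]
    omega

/-- Flattening undoes inflating: the crosses of `P` reappear. -/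
theorem subset_flatten_inflate {P : Set (ℕ × ℕ)} (hP : P ⊆ shape k n) :
    P ⊆ flatten h (inflate k u h (full k n P) ∩ shape k (n + 1)) ∩ shape k n := by
  rintro ⟨x, y⟩ hd
  have hs := hP hd
  refine ⟨?_, hs⟩
  rcases le_or_gt (h y) x with h1 | h1
  · refine Or.inl ⟨h1, Or.inl ⟨h1, subset_full hd⟩, ?_⟩
    simp only [shape, Set.mem_ofPred_eq] at *
    omega
  · refine Or.inr ⟨h1, Or.inr ⟨y, rfl, Or.inl ⟨h1, subset_full hd⟩⟩, ?_⟩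
    simp only [shape, Set.mem_ofPred_eq] at *
    omega

/-- Inflating a `k`-triangulation along a `k`-crossing gives a `k`-triangulation. A diagonal that
starts in a row `≤ u` and could be added would survive flattening; one that starts below row `u`
crosses `k` sides of the star, or all members of a `k`-crossing obtained by moving a `k`-crossing
of the smaller polygon to the right. -/
theorem inflate_mem (hk : 2 ≤ k) (H : IsStar k u h) (hku : k ≤ u) (hun : u + k ≤ n)
    {P : Set (ℕ × ℕ)} (hP : P ∈ kTriangulations k n) (hrow : ∀ d ∈ P, d.1 ≤ u)
    (hside : ∀ y, u < y → y ≤ u + k → (h y, y) ∈ full k n P) :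
    inflate k u h (full k n P) ∩ shape k (n + 1) ∈ kTriangulations k (n + 1) := by
  have hk1 : 1 ≤ k := by omega
  have hPs := subset_shape hk1 hP
  have hfree := not_hasCrossing_full hk1 hP
  set T := inflate k u h (full k n P) ∩ shape k (n + 1) with hTdef
  have hrowT : ∀ d ∈ T, d.1 ≤ u := fun d hd => inflate_full_row_le H hrow hd.1 hd.2
  have hs : HasSides k u h (full k (n + 1) T) := hasSides_inflate H hk hun hside
  have hPT : P ⊆ flatten h T ∩ shape k n := subset_flatten_inflate hPs
  refine mem_kTriangulations_of_insert hk1 Set.inter_subset_right ?_ ?_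
  · exact fun hc => hfree (HasCrossing.of_inflate H hside Set.inter_subset_left hrowT hc)
  rintro ⟨x, y⟩ hd hc
  have hins : insert (x, y) T ⊆ shape k (n + 1) := Set.insert_subset hd Set.inter_subset_right
  have hc' : ¬ HasCrossing (k + 1) (full k (n + 1) (insert (x, y) T)) :=
    fun h => hc (h.of_full hk1 hins)
  have hs' : HasSides k u h (full k (n + 1) (insert (x, y) T)) := fun z h1 h2 =>
    ⟨full_mono (Set.subset_insert _ _) (hs z h1 h2).1,
      full_mono (Set.subset_insert _ _) (hs z h1 h2).2⟩
  rcases lt_trichotomy x (u + 1) with hx | rfl | hx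
  · have hrow' : ∀ d ∈ insert (x, y) T, d.1 ≤ u := by
      rintro d (rfl | hd)
      exacts [Nat.lt_succ_iff.1 hx, hrowT d hd]
    have hQ : flatten h (insert (x, y) T) ∩ shape k n = P := by
      refine eq_of_subset hk1 hP (fun d hd => ⟨flatten_mono (Set.subset_insert _ _) (hPT hd).1,
        (hPT hd).2⟩) Set.inter_subset_right fun hcr => hc' ?_
      exact HasCrossing.of_flatten H (fun z h1 h2 => (hs' z h1 h2).1)
        (Set.inter_subset_left.trans (flatten_mono subset_full))
        (fun d hd => flatten_row_le hrow' d hd.1) hcr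
    have hQ' : flatten h (insert (x, y) T) ⊆ full k n P := by
      rw [← hQ]
      exact flatten_subset_full hk H hins hrow' hun
    refine ⟨?_, hd⟩
    rcases le_or_gt (h y) x with h1 | h1
    · exact Or.inl ⟨h1, hQ' (Or.inl ⟨h1, Set.mem_insert _ _⟩)⟩
    · have hy := H.lt_of_pos h1
      obtain ⟨z, rfl⟩ : ∃ z, y = z + 1 := ⟨y - 1, by omega⟩
      refine Or.inr ⟨z, rfl, ?_⟩
      rcases lt_trichotomy x (h z) with h2 | h2 | h2
      · exact Or.inl ⟨h2, hQ' (Or.inr ⟨h2, Set.mem_insert _ _⟩)⟩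
      · refine Or.inr ⟨h2, ?_, H.le_of_row_le (by omega)⟩
        by_contra h4
        have := H.eq_zero z (by omega)
        simp only [shape, Set.mem_ofPred_eq] at hd
        omega
      · exact absurd (HasCrossing.of_gap H hs' (subset_full (Set.mem_insert _ _)) (by omega)
          (H.le_of_row_le (by omega)) h2 h1) hc'
  · refine absurd (HasCrossing.of_row_succ H hs' (subset_full (Set.mem_insert _ _)) ?_) hc'
    simp only [shape, Set.mem_ofPred_eq] at hd
    omega
  · exfalso
    obtain ⟨c, rfl⟩ : ∃ c, x = c + 1 := ⟨x - 1, by omega⟩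
    have hd' : (c, c + k + 1) ∈ shape k n := by
      simp only [shape, Set.mem_ofPred_eq] at *
      omega
    obtain ⟨C, hC, hcard, hp, hcr⟩ := exists_crossing_of_notMem hk1 hP hd'
      fun h => by have := hrow _ h; simp only at this; omega
    have hcol : ∀ e ∈ C, e.1 ≤ u ∧ c < e.2 ∧ e.2 < c + k + 1 := fun e he => by
      have h1 := hrow _ (hC he)
      have h2 := hcr e he
      simp only [Crosses] at h2
      omega
    set g : ℕ × ℕ → ℕ × ℕ := fun e => (min e.1 (h e.2), e.2 + 1) with hg
    have hlt : ∀ d ∈ C, ∀ e ∈ C, Before d e → Before (g d) (g e) := by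
      intro d hd e he hde
      have h1 := hcol d hd
      have h2 := hcol e he
      simp only [Before, hg] at *
      have := H.lt (y := d.2) (z := e.2) (by omega) (by omega)
      omega
    have hmem : ∀ e ∈ C, g e ∈ full k (n + 1) T := by
      rintro ⟨e, z⟩ he
      have h1 := hcol _ he
      have h3 := hPs (hC he)
      simp only [hg] at *
      rcases lt_or_ge e (h z) with h2 | h2
      · rw [min_eq_left h2.le]
        refine subset_full ⟨Or.inr ⟨z, rfl, Or.inl ⟨h2, subset_full (hC he)⟩⟩, ?_⟩
        simp only [shape, Set.mem_ofPred_eq] at *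
        omega
      · rw [min_eq_right h2]
        exact (hs z (by omega) (H.le_of_row_le (by omega))).2
    refine hc' ?_
    obtain ⟨C', hC', hcard', hp'⟩ := HasCrossing.of_map (S := g '' C) hp g
      (fun e he => Set.mem_image_of_mem g he) hlt
    refine HasCrossing.mono (HasCrossing.insert (d := (c + 1, y)) hC' (hcard'.trans hcard) hp'
      ?_) ?_
    · intro e he
      obtain ⟨e, he', rfl⟩ := hC' he
      have h1 := hcol e he'
      simp only [shape, Set.mem_ofPred_eq] at hd
      simp only [Crosses, hg]
      omega
    · refine Set.insert_subset (subset_full (Set.mem_insert _ _)) ?_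
      rintro _ ⟨e, he, rfl⟩
      exact full_mono (Set.subset_insert _ _) (hmem e he)

theorem inflate_flatten_eq (hk : 2 ≤ k) (H : IsStar k u h) (hku : k ≤ u) (hun : u + k ≤ n)
    {T : Set (ℕ × ℕ)} (hT : T ∈ kTriangulations k (n + 1)) (hrow : ∀ d ∈ T, d.1 ≤ u)
    (hs : HasSides k u h (full k (n + 1) T)) :
    inflate k u h (full k n (flatten h T ∩ shape k n)) ∩ shape k (n + 1) = T := by
  have hk1 : 1 ≤ k := by omega
  have hTs := subset_shape hk1 hT
  have hfree := not_hasCrossing_full hk1 hT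
  have hP := flatten_mem hk H hku hun hT hrow hs
  have hW := inflate_mem hk H hku hun hP (fun d hd => flatten_row_le hrow d hd.1)
    (side_mem_full_flatten H hk hun hs)
  refine eq_of_subset hk1 hT (fun d hd => ⟨subset_inflate_flatten H hTs hrow hk hun hs hfree hd,
    hTs hd⟩) Set.inter_subset_right ((mem_kTriangulations_iff hk1).1 hW).prop.2

theorem flatten_inflate_eq (hk : 2 ≤ k) (H : IsStar k u h) (hku : k ≤ u) (hun : u + k ≤ n)
    {P : Set (ℕ × ℕ)} (hP : P ∈ kTriangulations k n) (hrow : ∀ d ∈ P, d.1 ≤ u)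
    (hside : ∀ y, u < y → y ≤ u + k → (h y, y) ∈ full k n P) :
    flatten h (inflate k u h (full k n P) ∩ shape k (n + 1)) ∩ shape k n = P := by
  have hk1 : 1 ≤ k := by omega
  have hT := inflate_mem hk H hku hun hP hrow hside
  have hQ := flatten_mem hk H hku hun hT
    (fun d hd => inflate_full_row_le H hrow hd.1 hd.2) (hasSides_inflate H hk hun hside)
  exact eq_of_subset hk1 hP (subset_flatten_inflate (subset_shape hk1 hP))
    Set.inter_subset_right ((mem_kTriangulations_iff hk1).1 hQ).prop.2

end

end

/-! ### The corner -/

section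
variable {k n : ℕ} {T : Set (ℕ × ℕ)}

/-- Every nontrivial diagonal of a `k`-triangulation cuts off, or is, a short diagonal
`(c, c + k + 1)`. -/
theorem exists_short (hk : 1 ≤ k) (hT : T ∈ kTriangulations k n) :
    ∀ {a b : ℕ}, (a, b) ∈ T → ∃ c, a ≤ c ∧ c + k + 1 ≤ b ∧ (c, c + k + 1) ∈ T := by
  have hTs := subset_shape hk hT
  suffices ∀ l a b : ℕ, b - a ≤ l → (a, b) ∈ T →
      ∃ c, a ≤ c ∧ c + k + 1 ≤ b ∧ (c, c + k + 1) ∈ T from fun {a b} => this _ a b le_rfl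
  intro l
  induction l with
  | zero =>
    intro a b hl hab
    have := hTs hab
    simp only [shape, Set.mem_ofPred_eq] at this
    omega
  | succ l ih =>
    intro a b hl hab
    have hsh := hTs hab
    simp only [shape, Set.mem_ofPred_eq] at hsh
    rcases Nat.eq_or_lt_of_le (show a + k + 1 ≤ b by omega) with rfl | hlt
    · exact ⟨a, le_rfl, le_rfl, hab⟩
    -- a `k`-crossing that crosses `(a, b - 1)` but does not extend by `(a, b)` has a member
    -- `(c, b)` with `a < c`
    suffices ∃ a' b', a ≤ a' ∧ b' ≤ b ∧ b' - a' ≤ l ∧ (a', b') ∈ T by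
      obtain ⟨a', b', h1, h2, h3, h4⟩ := this
      obtain ⟨c, h5, h6, h7⟩ := ih a' b' h3 h4
      exact ⟨c, by omega, by omega, h7⟩
    by_cases hmem : (a, b - 1) ∈ T
    · exact ⟨a, b - 1, le_rfl, by omega, by omega, hmem⟩
    have hsh' : (a, b - 1) ∈ shape k n := by
      simp only [shape, Set.mem_ofPred_eq]
      omega
    obtain ⟨C, hC, hcard, hp, hcr⟩ := exists_crossing_of_notMem hk hT hsh' hmem
    obtain ⟨⟨c, d⟩, he, hne⟩ : ∃ e ∈ C, ¬ Crosses (a, b) e := by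
      by_contra! hall
      refine ((mem_kTriangulations_iff hk).1 hT).prop.2 ?_
      exact (HasCrossing.insert hC hcard hp hall).mono (Set.insert_subset hab subset_rfl)
    have h1 := hcr _ he
    have h2 := hTs (hC he)
    simp only [Crosses, shape, Set.mem_ofPred_eq] at h1 h2 hne
    refine ⟨c, d, ?_, ?_, ?_, hC he⟩ <;> omega

theorem nonempty_of_mem (hk : 1 ≤ k) (hn : 2 * k + 2 ≤ n) (hT : T ∈ kTriangulations k n) :
    T.Nonempty := by
  rw [Set.nonempty_iff_ne_empty]
  rintro rfl
  obtain ⟨C, hC, hcard, -⟩ := exists_crossing_of_notMem hk hT (d := (1, k + 2))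
    (by simp only [shape, Set.mem_ofPred_eq]; omega) (Set.notMem_empty _)
  obtain ⟨e, he⟩ := Finset.card_pos.1 (show 0 < C.card by omega)
  exact hC he

theorem isGreatest_corner (hk : 1 ≤ k) (hn : 2 * k + 2 ≤ n) (hT : T ∈ kTriangulations k n) :
    IsGreatest (shortRows k n T) (corner k n T) := by
  obtain ⟨⟨a, b⟩, hab⟩ := nonempty_of_mem hk hn hT
  obtain ⟨c, -, -, hc⟩ := exists_short hk hT hab
  have hcs := subset_shape hk hT hc
  simp only [shape, Set.mem_ofPred_eq] at hcs
  have hne : (shortRows k n T).Nonempty := ⟨c, hcs.1, hcs.2.2.1, hc⟩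
  have hbdd : BddAbove (shortRows k n T) := ⟨n, fun x hx => by
    have := hx.2.1
    omega⟩
  rw [corner, if_pos hne]
  exact ⟨Nat.sSup_mem hne hbdd, fun x hx => le_csSup hbdd hx⟩

theorem row_le_corner (hk : 1 ≤ k) (hn : 2 * k + 2 ≤ n) (hT : T ∈ kTriangulations k n) :
    ∀ d ∈ T, d.1 ≤ corner k n T := by
  rintro ⟨a, b⟩ hab
  obtain ⟨c, h1, -, hc⟩ := exists_short hk hT hab
  have hcs := subset_shape hk hT hc
  simp only [shape, Set.mem_ofPred_eq] at hcs
  exact h1.trans ((isGreatest_corner hk hn hT).2 ⟨hcs.1, hcs.2.2.1, hc⟩)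

/-- If the corner were less than `k`, there would not be enough rows for the `k`-crossing that
keeps the short diagonal after the corner out of `T`. -/
theorem le_corner (hk : 1 ≤ k) (hn : 2 * k + 2 ≤ n) (hT : T ∈ kTriangulations k n) :
    k ≤ corner k n T := by
  by_contra! hlt
  set r := corner k n T
  have hrow := row_le_corner hk hn hT
  obtain ⟨C, hC, hcard, hp, hcr⟩ := exists_crossing_of_notMem hk hT (d := (r + 1, r + k + 2))
    (by simp only [shape, Set.mem_ofPred_eq]; omega)
    (fun h => by have := hrow _ h; simp only at this; omega)
  have hle : C.card ≤ (Finset.Icc 1 r).card := by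
    refine Finset.card_le_card_of_injOn Prod.fst ?_ ?_
    · intro e he
      have h1 := subset_shape hk hT (hC he)
      have h2 := hrow _ (hC he)
      simp only [shape, Set.mem_ofPred_eq] at h1
      simp only [Finset.coe_Icc, Set.mem_Icc]
      exact ⟨h1.1, h2⟩
    · intro d hd e he hde
      by_contra hne
      have := hp hd he hne
      simp only [Crosses] at this
      omega
  rw [Nat.card_Icc] at hle
  omega

theorem eq_empty_of_mem (hk : 1 ≤ k) (hT : T ∈ kTriangulations k (2 * k + 1)) : T = ∅ := by
  rw [Set.eq_empty_iff_forall_notMem]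
  intro d hd
  have := subset_shape hk hT hd
  simp only [shape, Set.mem_ofPred_eq] at this
  omega

theorem kTriangulations_base (hk : 1 ≤ k) : kTriangulations k (2 * k + 1) = {∅} := by
  refine Set.Subset.antisymm (fun T hT => eq_empty_of_mem hk hT) ?_
  rintro _ rfl
  refine mem_kTriangulations_of_insert hk (Set.empty_subset _) ?_ ?_
  · rintro ⟨C, hC, hcard, -⟩
    obtain ⟨e, he⟩ := Finset.card_pos.1 (show 0 < C.card by omega)
    exact hC he
  · intro d hd
    simp only [shape, Set.mem_ofPred_eq] at hd
    omega

theorem corner_eq_of_base (hk : 1 ≤ k) (hT : T ∈ kTriangulations k (2 * k + 1)) :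
    corner k (2 * k + 1) T = k := by
  rw [eq_empty_of_mem hk hT, corner, if_neg]
  rintro ⟨a, -, -, ha⟩
  exact ha

end

/-! ### The star at the corner -/

/-- The function on columns that encodes the star with vertices `a 1, …, a (k - 1), u` and
`u + 1, …, u + k + 1`. -/
def starFun (k u : ℕ) (a : ℕ → ℕ) (y : ℕ) : ℕ :=
  if y ≤ u then 0 else if u + k ≤ y then y - k else a (y - u)

section
variable {k u : ℕ} {a : ℕ → ℕ}

theorem starFun_of_le {y : ℕ} (hy : y ≤ u) : starFun k u a y = 0 := if_pos hy

theorem starFun_of_add_le (hk : 1 ≤ k) {y : ℕ} (hy : u + k ≤ y) : starFun k u a y = y - k := by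
  rw [starFun, if_neg (by omega), if_pos hy]

theorem starFun_add {i : ℕ} (hi : 1 ≤ i) (hik : i < k) : starFun k u a (u + i) = a i := by
  rw [starFun, if_neg (by omega), if_neg (by omega), Nat.add_sub_cancel_left]

theorem isStar_starFun (hk : 2 ≤ k) (hku : k ≤ u) (h1 : 1 ≤ a 1)
    (hlt : ∀ i, 1 ≤ i → i + 1 < k → a i < a (i + 1)) (hlast : a (k - 1) < u) :
    IsStar k u (starFun k u a) := by
  refine ⟨fun y => starFun_of_le, fun y hy => ?_, fun y hy => ?_⟩
  · obtain ⟨i, rfl⟩ := Nat.exists_eq_add_of_le hy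
    rcases Nat.eq_zero_or_pos i with rfl | hi
    · rw [starFun_of_le (by omega), starFun_add le_rfl (by omega)]
      exact h1
    rcases lt_trichotomy (i + 1) k with h2 | h2 | h2
    · rw [starFun_add hi (by omega), add_assoc, starFun_add (by omega) h2]
      exact hlt i hi h2
    · obtain rfl : i = k - 1 := by omega
      rw [starFun_add hi (by omega), starFun_of_add_le (by omega) (by omega)]
      omega
    · rw [starFun_of_add_le (by omega) (by omega), starFun_of_add_le (by omega) (by omega)]
      omega
  · rw [starFun_of_add_le (by omega) hy]
    omega

end

section
variable {k n r : ℕ} {T : Set (ℕ × ℕ)}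

theorem row_add_le_of_mem_setA (hT : T ⊆ shape k n) (hkr : k ≤ r) {i x : ℕ}
    (hx : x ∈ setA k r T i) : x + k ≤ r + i := by
  rcases hx with hx | hx
  · have := hT hx
    simp only [shape, Set.mem_ofPred_eq] at this
    omega
  · rw [Set.mem_singleton_iff] at hx
    omega

theorem isLeast_idxA (hT : T ⊆ shape k n) (hkr : k ≤ r) :
    ∀ i : ℕ, 1 ≤ i → IsLeast {a | a ∈ setA k r T i ∧ (i = 1 ∨ idxA k r T (i - 1) < a)}
      (idxA k r T i) := by
  have key : ∀ {S : Set ℕ}, S.Nonempty → IsLeast S (sInf S) := fun hS =>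
    ⟨Nat.sInf_mem hS, fun x hx => Nat.sInf_le hx⟩
  intro i hi
  induction i, hi using Nat.le_induction with
  | base =>
    convert key (S := setA k r T 1) ⟨r + 1 - k, Or.inr rfl⟩ using 1
    · ext x
      simp
    · rw [idxA]
  | succ i hi ih =>
    obtain ⟨j, rfl⟩ : ∃ j, i = j + 1 := ⟨i - 1, by omega⟩
    have h1 := row_add_le_of_mem_setA hT hkr ih.1.1
    convert key (S := {x | x ∈ setA k r T (j + 2) ∧ idxA k r T (j + 1) < x})
      ⟨r + (j + 2) - k, Or.inr rfl, by omega⟩ using 1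
    · ext x
      simp
    · rw [idxA]

/-- The star of `T` at row `r` exists: the trivial diagonal `(r + i - k, r + i)` is always
available as a side. -/
theorem isStar_idxA (hT : T ⊆ shape k n) (hk : 2 ≤ k) (hkr : k ≤ r) :
    IsStar k r (starFun k r (idxA k r T)) := by
  have hleast := isLeast_idxA hT hkr
  refine isStar_starFun hk hkr ?_ ?_ ?_
  · rcases (hleast 1 le_rfl).1.1 with h1 | h1
    · exact (hT h1).1
    · rw [h1]
      omega
  · intro i hi hik
    have := (hleast (i + 1) (by omega)).1.2
    rw [Nat.add_sub_cancel] at this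
    exact this.resolve_left (by omega)
  · have := row_add_le_of_mem_setA hT hkr (hleast (k - 1) (by omega)).1.1
    omega

/-- If the sides `(h y, y)` of a star are in `T` and column `y + 1` of `T` has no cross strictly
between the rows `h y` and `h (y + 1)`, then the sides `(h y, y + 1)` are in `T` as well.
Otherwise all members of some `k`-crossing of `T` cross `(h y, y + 1)`. Adding this diagonal gives
a `(k + 1)`-crossing, in which `(h y, y + 1)` and the maximal run of crosses above the star in the
consecutive columns to the left of it are replaced by the sides `(h z, z)` one column to the
left; this is a `(k + 1)`-crossing of `T`. -/
theorem right_side_mem {h : ℕ → ℕ} (hk : 2 ≤ k) (H : IsStar k r h)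
    (hT : T ∈ kTriangulations k n) (hrow : ∀ d ∈ T, d.1 ≤ r)
    (hside : ∀ y, r < y → y ≤ r + k → (h y, y) ∈ full k n T)
    (hgap : ∀ x y, r ≤ y → y + 1 < r + k → (x, y + 1) ∈ T → x ≤ h y ∨ h (y + 1) ≤ x)
    {y : ℕ} (hy : r < y) (hy' : y < r + k) (hd : (h y, y + 1) ∈ diagonals n) :
    (h y, y + 1) ∈ full k n T := by
  classical
  have hk1 : 1 ≤ k := by omega
  refine mem_full_of_imp hd fun hsh => ?_
  by_contra hnot
  obtain ⟨C, hC, rfl, hp, hcr⟩ := exists_crossing_of_notMem hk1 hT hsh hnot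
  have hTs := subset_shape hk1 hT
  set d : ℕ × ℕ := (h y, y + 1) with hddef
  have hdC : d ∉ C := fun hd => hnot (hC hd)
  set run : ℕ → Prop := fun z => ∀ i, z ≤ i → i ≤ y → ∃ x, (x, i) ∈ C ∧ x < h i with hrun
  have hhr : ∀ z, z ≤ y → h z ≤ r := fun z hz => H.le_of_le (by omega)
  have uniq : ∀ {x x' y : ℕ}, (x, y) ∈ C → (x', y) ∈ C → x = x' := fun h1 h2 =>
    congrArg Prod.fst (eq_of_snd_eq hp h1 h2 rfl)
  have hgap' : ∀ x z, r < z + 1 → z + 1 ≤ y → (x, z + 1) ∈ C → x < h (z + 1) → x ≤ h z :=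
    fun x z h1 h2 h3 h4 => (hgap x z (by omega) (by omega) (hC h3)).resolve_right (by omega)
  -- a run that starts to the right of column `r` starts to the right of column `r + 1`
  have hstart : ∀ z, r < z → z ≤ y + 1 → run z → r + 1 < z := by
    intro z h1 h2 h3
    by_contra h4
    obtain rfl : z = r + 1 := by omega
    obtain ⟨x, h5, h6⟩ := h3 (r + 1) le_rfl (by omega)
    have h7 := hgap' x r (by omega) (by omega) h5 h6
    rw [H.eq_zero r le_rfl] at h7
    have := hTs (hC h5)
    simp only [shape, Set.mem_ofPred_eq] at this
    omega
  set D := insert d C with hD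
  have hDcard : D.card = C.card + 1 := Finset.card_insert_of_notMem hdC
  have hDp : (D : Set (ℕ × ℕ)).Pairwise Crosses := by
    rw [hD, Finset.coe_insert]
    exact hp.insert fun e he _ => ⟨hcr e he, (hcr e he).symm⟩
  have hDd : d ∈ D := Finset.mem_insert_self _ _
  have hDrow : ∀ e ∈ D, e.1 ≤ r := fun e he => by
    rcases Finset.mem_insert.1 he with rfl | he
    · exact hhr y le_rfl
    · exact hrow _ (hC he)
  refine not_hasCrossing_full hk1 hT (hDcard ▸ HasCrossing.of_map hDp
    (fun e => if r < e.2 ∧ e.2 ≤ y + 1 ∧ run e.2 then (h (e.2 - 1), e.2 - 1) else e) ?_ ?_)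
  · rintro ⟨x, z⟩ he
    by_cases hz : r < z ∧ z ≤ y + 1 ∧ run z
    · have h1 := hstart z hz.1 hz.2.1 hz.2.2
      simp only [hz, true_and, if_true]
      exact hside (z - 1) (by omega) (by omega)
    · simp only [hz, if_false]
      refine subset_full (hC ((Finset.mem_insert.1 he).resolve_left fun h => hz ?_))
      rw [hddef, Prod.mk.injEq] at h
      exact ⟨by omega, by omega, fun i _ _ => by omega⟩
  · rintro ⟨x, z⟩ he ⟨x', z'⟩ he' hlt
    have hx := hDrow _ he
    have hx' := hDrow _ he'
    simp only [Before] at hlt hx hx'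
    obtain ⟨h1, h2, h3⟩ := hlt
    by_cases c : r < z ∧ z ≤ y + 1 ∧ run z <;> by_cases c' : r < z' ∧ z' ≤ y + 1 ∧ run z'
    · have h4 := hstart z c.1 c.2.1 c.2.2
      have h5 := H.lt (y := z - 1) (z := z' - 1) (by omega) (by omega)
      have h6 := hhr (z' - 1) (by omega)
      simp only [Before, c, c', true_and, if_true]
      omega
    · have h4 := hstart z c.1 c.2.1 c.2.2
      have hz' : y + 1 < z' := by
        by_contra hz'
        exact c' ⟨by omega, by omega, fun i hi => c.2.2 i (by omega)⟩
      have h5 := (before_of_snd_lt hDp hDd he' hz').1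
      have h6 := H.mono (show z - 1 ≤ y by omega)
      simp only [hddef] at h5
      simp only [Before, c, c', true_and, if_true, if_false]
      omega
    · have h4 := hstart z' c'.1 c'.2.1 c'.2.2
      -- the new diagonal starts no later than `d`, and `d` crosses `(x, z)`
      have h5 : h y < z := by
        have := (before_of_snd_lt hDp he hDd (by simp only [hddef]; omega)).2.1
        simpa only [hddef] using this
      have h6 := H.mono (show z' - 1 ≤ y by omega)
      have h7 : x' ≤ h (z' - 1) := by
        rcases Finset.mem_insert.1 he' with h7 | h7
        · rw [hddef, Prod.mk.injEq] at h7
          rw [h7.1, h7.2, Nat.add_sub_cancel]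
        · have hz' : z' ≤ y := by
            by_contra hz'
            obtain rfl : z' = y + 1 := by omega
            exact hdC (eq_of_snd_eq hDp hDd he' rfl ▸ h7)
          obtain ⟨w, rfl⟩ : ∃ w, z' = w + 1 := ⟨z' - 1, by omega⟩
          obtain ⟨x'', h8, h9⟩ := c'.2.2 (w + 1) le_rfl hz'
          obtain rfl := uniq h8 h7
          exact hgap' _ _ c'.1 hz' h7 h9
      have h8 : z ≠ z' - 1 := by
        rintro rfl
        refine c ⟨by omega, by omega, fun i hi hi' => ?_⟩
        rcases hi.eq_or_lt with rfl | h8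
        · refine ⟨x, (Finset.mem_insert.1 he).resolve_left fun h8 => ?_, by omega⟩
          rw [hddef, Prod.mk.injEq] at h8
          omega
        · exact c'.2.2 i (by omega) hi'
      simp only [Before, c, c', true_and, if_true, if_false]
      omega
    · simp only [Before, c, c', if_false]
      exact ⟨h1, h2, h3⟩

end

/-! ### The parent -/

section
variable {k n : ℕ} {T : Set (ℕ × ℕ)}

/-- The function on columns that encodes the star of `T` at its corner. -/
noncomputable def cornerStar (k n : ℕ) (T : Set (ℕ × ℕ)) : ℕ → ℕ :=
  starFun k (corner k n T) (idxA k (corner k n T) T)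

theorem isStar_cornerStar (hk : 2 ≤ k) (hn : 2 * k + 2 ≤ n) (hT : T ∈ kTriangulations k n) :
    IsStar k (corner k n T) (cornerStar k n T) :=
  isStar_idxA (subset_shape (by omega) hT) hk (le_corner (by omega) hn hT)

theorem corner_add_lt (hk : 2 ≤ k) (hn : 2 * k + 2 ≤ n) (hT : T ∈ kTriangulations k n) :
    corner k n T + k + 1 ≤ n := (isGreatest_corner (by omega) hn hT).1.2.1

theorem hasSides_cornerStar (hk : 2 ≤ k) (hn : 2 * k + 2 ≤ n) (hT : T ∈ kTriangulations k n) :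
    HasSides k (corner k n T) (cornerStar k n T) (full k n T) := by
  have hk1 : 1 ≤ k := by omega
  have hTs := subset_shape hk1 hT
  have H := isStar_cornerStar hk hn hT
  have hg := isGreatest_corner hk1 hn hT
  have hrow := row_le_corner hk1 hn hT
  have hkr := le_corner hk1 hn hT
  have hadd : ∀ i, 1 ≤ i → i < k → cornerStar k n T (corner k n T + i) =
    idxA k (corner k n T) T i := fun i => starFun_add
  set r := corner k n T
  set h := cornerStar k n T
  have hrn : r + k + 1 ≤ n := hg.1.2.1
  have hleast := isLeast_idxA hTs hkr
  have hside : ∀ y, r < y → y ≤ r + k → (h y, y) ∈ full k n T := by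
    intro y h1 h2
    have h3 := H.le_add h1.le
    have h4 := H.add_le h1
    refine mem_full_of_imp ?_ fun hsh => ?_
    · simp only [diagonals, Set.mem_ofPred_eq, ne_eq, Prod.mk.injEq]
      omega
    · simp only [shape, Set.mem_ofPred_eq] at hsh
      rcases h2.eq_or_lt with rfl | h2
      · have := H.add_eq (r + k) le_rfl
        omega
      · obtain ⟨i, rfl⟩ := Nat.exists_eq_add_of_lt h1
        have h5 := hadd (i + 1) (by omega) (by omega)
        rcases (hleast (i + 1) (by omega)).1.1 with h6 | h6
        · rw [← h5] at h6
          exact h6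
        · rw [Set.mem_singleton_iff, ← h5, ← add_assoc] at h6
          omega
  have hgap : ∀ x y, r ≤ y → y + 1 < r + k → (x, y + 1) ∈ T → x ≤ h y ∨ h (y + 1) ≤ x := by
    intro x y h1 h2 hx
    by_contra! hcon
    obtain ⟨i, rfl⟩ := Nat.exists_eq_add_of_le h1
    have h3 := hadd (i + 1) (by omega) (by omega)
    rw [← add_assoc] at h3
    refine absurd (mem_lowerBounds.1 (hleast (i + 1) (by omega)).2 x ⟨Or.inl hx, ?_⟩) (by omega)
    rcases Nat.eq_zero_or_pos i with rfl | hi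
    · exact Or.inl rfl
    · rw [Nat.add_sub_cancel, ← hadd i hi (by omega)]
      exact Or.inr hcon.1
  refine fun y h1 h2 => ⟨hside y h1 h2, ?_⟩
  rcases h2.eq_or_lt with rfl | h2
  · have : h (r + k) = r := by have := H.add_eq (r + k) le_rfl; omega
    rw [this]
    exact subset_full hg.1.2.2
  · have h3 := H.le_add h1.le
    have h4 := H.add_le h1
    refine right_side_mem hk H hT hrow hside hgap h1 h2 ?_
    simp only [diagonals, Set.mem_ofPred_eq, ne_eq, Prod.mk.injEq]
    omega

theorem cornerStar_add (hk : 2 ≤ k) (hn : 2 * k + 2 ≤ n) (hT : T ∈ kTriangulations k n) {i : ℕ}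
    (hi : 1 ≤ i) (hik : i ≤ k) :
    cornerStar k n T (corner k n T + i) = idxA k (corner k n T) T i := by
  rcases hik.lt_or_eq with h1 | rfl
  · exact starFun_add hi h1
  have hk1 : 1 ≤ i := by omega
  have H := isStar_cornerStar hk hn hT
  have hs := hasSides_cornerStar hk hn hT
  have hleast := isLeast_idxA (subset_shape hk1 hT) (le_corner hk1 hn hT) i hk1
  have hadd : cornerStar i n T (corner i n T + (i - 1)) = idxA i (corner i n T) T (i - 1) :=
    starFun_add (by omega) (by omega)
  have heq := H.add_eq _ le_rfl
  set r := corner i n T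
  set h := cornerStar i n T
  have hr : h (r + i) = r := by omega
  have hr' : h (r + (i - 1) + 1) = r := by rw [← hr]; congr 1; omega
  rw [hr]
  rcases hleast.1.1 with h1 | h1
  · by_contra hne
    have h2 := hleast.1.2.resolve_left (by omega)
    have h3 : idxA i r T i + i ≤ r + i :=
      row_add_le_of_mem_setA (subset_shape hk1 hT) (le_corner hk1 hn hT) hleast.1.1
    refine not_hasCrossing_full hk1 hT (HasCrossing.of_gap H hs (z := r + (i - 1))
      (subset_full ?_) (by omega) (by omega) (hadd ▸ h2) ?_)
    swap
    · rw [hr']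
      omega
    rw [show r + (i - 1) + 1 = r + i by omega]
    exact h1
  · rw [Set.mem_singleton_iff] at h1
    omega

/-- The parent operation is flattening along the star at the corner. -/
theorem parent_eq_flatten (hk : 2 ≤ k) (hn : 2 * k + 1 ≤ n) (hT : T ∈ kTriangulations k (n + 1)) :
    parent k (n + 1) T = flatten (cornerStar k (n + 1) T) T ∩ shape k n := by
  have hk1 : 1 ≤ k := by omega
  have hTs := subset_shape hk1 hT
  have H := isStar_cornerStar hk (by omega) hT
  have hrow := row_le_corner hk1 (by omega) hT
  have hkr := le_corner hk1 (by omega) hT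
  have hrn := corner_add_lt hk (by omega) hT
  have hadd : ∀ i, 1 ≤ i → i + 1 ≤ k → cornerStar k (n + 1) T (corner k (n + 1) T + i) =
    idxA k (corner k (n + 1) T) T i := fun i => starFun_add
  rw [parent]
  set r := corner k (n + 1) T
  set h := cornerStar k (n + 1) T
  ext ⟨x, y⟩
  simp only [Set.mem_union, Set.mem_inter_iff, mem_flatten, Set.mem_ofPred_eq]
  constructor
  · rintro ((⟨h1, h2⟩ | ⟨⟨i, h1, h2, rfl, h3⟩, h4⟩) | ⟨h1, h2, h3⟩)
    · have h5 := hTs h2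
      refine ⟨Or.inl ⟨by rw [H.eq_zero y h1]; omega, h2⟩, ?_⟩
      simp only [shape, Set.mem_ofPred_eq] at *
      omega
    · rw [← hadd i h1 h2] at h3
      refine ⟨h3, ?_⟩
      rcases h3 with ⟨h5, h6⟩ | ⟨h5, h6⟩
      · have h7 := hTs h6
        have h8 := H.le_add (show r ≤ r + i by omega)
        simp only [shape, Set.mem_ofPred_eq] at *
        omega
      · have h7 := hTs h6
        have h8 := H.add_le (show r < r + i by omega)
        simp only [shape, Set.mem_ofPred_eq] at *
        omega
    · have h4 := hTs h2
      have h5 := H.add_eq y h1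
      have h6 := hrow _ h2
      simp only [shape, Set.mem_ofPred_eq] at *
      exact ⟨Or.inr ⟨by omega, h2⟩, by omega⟩
  · rintro ⟨h1, h2⟩
    simp only [shape, Set.mem_ofPred_eq] at h2
    rcases le_or_gt y r with h3 | h3
    · rw [H.eq_zero y h3] at h1
      exact Or.inl (Or.inl ⟨h3, (h1.resolve_right fun h => by omega).2⟩)
    rcases lt_or_ge y (r + k) with h4 | h4
    · obtain ⟨i, rfl⟩ := Nat.exists_eq_add_of_le h3.le
      refine Or.inl (Or.inr ⟨⟨i, by omega, by omega, rfl, ?_⟩, by omega⟩)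
      rwa [← hadd i (by omega) (by omega)]
    · have h5 := H.add_eq y h4
      rcases h1 with ⟨h1, h6⟩ | ⟨h1, h6⟩
      · omega
      · exact Or.inr ⟨h4, h6, by omega⟩

theorem parent_mem (hk : 2 ≤ k) (hn : 2 * k + 1 ≤ n) (hT : T ∈ kTriangulations k (n + 1)) :
    parent k (n + 1) T ∈ kTriangulations k n := by
  rw [parent_eq_flatten hk hn hT]
  exact flatten_mem hk (isStar_cornerStar hk (by omega) hT) (le_corner (by omega) (by omega) hT)
    (by have := corner_add_lt hk (by omega) hT; omega) hT
    (row_le_corner (by omega) (by omega) hT) (hasSides_cornerStar hk (by omega) hT)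

theorem isTrivial_of_notMem_shape {d : ℕ × ℕ} (hd : d ∈ diagonals n) (h : d ∉ shape k n) :
    IsTrivial k n d := by
  refine ⟨hd, ?_⟩
  obtain ⟨a, b⟩ := d
  simp only [diagonals, shape, Set.mem_ofPred_eq, ne_eq, Prod.mk.injEq] at hd h ⊢
  rcases le_or_gt b (a + k) with h1 | h1
  · exact ⟨b - a, by omega, by omega, Or.inl (by omega)⟩
  · exact ⟨a + n - b, by omega, by omega, Or.inr (by omega)⟩

theorem idxA_side (hk : 2 ≤ k) (hn : 2 * k + 2 ≤ n) (hT : T ∈ kTriangulations k n) {i : ℕ}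
    (hi : 1 ≤ i) (hik : i ≤ k) :
    (idxA k (corner k n T) T i, corner k n T + i + 1) ∈ T ∨
      IsTrivial k n (idxA k (corner k n T) T i, corner k n T + i + 1) := by
  rw [← cornerStar_add hk hn hT hi hik]
  exact ((hasSides_cornerStar hk hn hT _ (by omega) (by omega)).2).imp_right
    fun h => isTrivial_of_notMem_shape h.1 h.2

theorem row_le_idxA_pred (hk : 2 ≤ k) (hn : 2 * k + 2 ≤ n) (hT : T ∈ kTriangulations k n) {a : ℕ}
    (ha : (a, corner k n T + k) ∈ T) : a ≤ idxA k (corner k n T) T (k - 1) := by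
  by_contra! hlt
  have h1 := mem_lowerBounds.1 (isLeast_idxA (subset_shape (by omega) hT)
    (le_corner (by omega) hn hT) k (by omega)).2 a ⟨Or.inl ha, Or.inr hlt⟩
  rw [← cornerStar_add hk hn hT (by omega) le_rfl] at h1
  have h2 := (isStar_cornerStar hk hn hT).add_eq _ le_rfl
  have h3 := subset_shape (by omega) hT ha
  simp only [shape, Set.mem_ofPred_eq] at h3
  omega

end

/-! ### The children -/

section
variable {k n : ℕ} {P : Set (ℕ × ℕ)}

/-- The extension of `b` to all natural numbers, by `0` outside `1, …, k - 1`. -/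
def extendIndex (k : ℕ) (b : Set.Icc 1 (k - 1) → ℕ) (i : ℕ) : ℕ :=
  if hi : 1 ≤ i ∧ i ≤ k - 1 then b ⟨i, hi⟩ else 0

/-- The function on columns that encodes the star created by the choice `(u, b)`. -/
def choiceStar (k u : ℕ) (b : Set.Icc 1 (k - 1) → ℕ) : ℕ → ℕ :=
  starFun k u (extendIndex k b)

theorem extendIndex_coe (b : Set.Icc 1 (k - 1) → ℕ) (i : Set.Icc 1 (k - 1)) :
    extendIndex k b i = b i := dif_pos i.2

theorem choiceStar_add (u : ℕ) (b : Set.Icc 1 (k - 1) → ℕ) (i : Set.Icc 1 (k - 1)) :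
    choiceStar k u b (u + i) = b i := by
  have h1 := i.2.1
  have h2 := i.2.2
  rw [choiceStar, starFun_add h1 (by omega), extendIndex_coe]

theorem row_le_corner_of_two_mul_lt (hk : 1 ≤ k) (hn : 2 * k + 1 ≤ n)
    (hP : P ∈ kTriangulations k n) :
    ∀ d ∈ P, d.1 ≤ corner k n P := by
  rcases hn.eq_or_lt with rfl | hn
  · rw [eq_empty_of_mem hk hP]
    exact fun d hd => absurd hd (Set.notMem_empty d)
  · exact row_le_corner hk hn hP

theorem le_corner_of_two_mul_lt (hk : 1 ≤ k) (hn : 2 * k + 1 ≤ n)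
    (hP : P ∈ kTriangulations k n) :
    k ≤ corner k n P := by
  rcases hn.eq_or_lt with rfl | hn
  · exact (corner_eq_of_base hk hP).ge
  · exact le_corner hk hn hP

variable {u : ℕ} {b : Set.Icc 1 (k - 1) → ℕ}

theorem isStar_choiceStar (hk : 2 ≤ k) (hn : 2 * k + 1 ≤ n) (hP : P ∈ kTriangulations k n)
    (hc : (u, b) ∈ choices k n P) : IsStar k u (choiceStar k u b) := by
  obtain ⟨h1, h2, h3, h4⟩ := hc
  have hku := (le_corner_of_two_mul_lt (by omega) hn hP).trans h1
  have hPs := subset_shape (by omega) hP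
  simp only at h1 h2 h3 hku
  have hb : ∀ i : Set.Icc 1 (k - 1), 1 ≤ b i ∧ b i < u := by
    intro i
    have hi := i.2
    simp only [Set.mem_Icc] at hi
    rcases h3 i with (h5 | h5) | h5
    · have := hPs h5
      simp only [shape, Set.mem_ofPred_eq] at this
      omega
    · rw [Set.mem_singleton_iff] at h5
      omega
    · simp only [Set.mem_ofPred_eq] at h5
      omega
  have hext : ∀ i (hi : 1 ≤ i ∧ i ≤ k - 1), extendIndex k b i = b ⟨i, hi⟩ :=
    fun i hi => dif_pos hi
  refine isStar_starFun hk hku ?_ ?_ ?_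
  · rw [hext 1 (by omega)]
    exact (hb _).1
  · intro i hi hik
    rw [hext i (by omega), hext (i + 1) (by omega)]
    exact h4 (Subtype.mk_lt_mk.2 (Nat.lt_succ_self i))
  · rw [hext (k - 1) (by omega)]
    exact (hb _).2

/-- The elements of `B_i` are the rows of the diagonals that end in column `u + i`, trivial ones
included, among those that can be vertices of a star. -/
theorem mem_setB_iff {h : ℕ → ℕ} (H : IsStar k u h) (hk : 2 ≤ k)
    (hun : u + k ≤ n) {i : ℕ} (hi : 1 ≤ i) (hik : i ≤ k) :
    h (u + i) ∈ setB k n u P i ↔ (h (u + i), u + i) ∈ full k n P := by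
  have h3 := H.add_le (show u < u + i by omega)
  have h4 := H.le_add (show u ≤ u + i by omega)
  constructor
  · intro h5
    refine mem_full_of_imp ?_ fun hs => ?_
    · simp only [diagonals, Set.mem_ofPred_eq, ne_eq, Prod.mk.injEq]
      omega
    · rcases h5 with (h5 | h5) | h5
      · exact h5
      · simp only [shape, Set.mem_ofPred_eq, Set.mem_singleton_iff] at *
        omega
      · simp only [shape, Set.mem_ofPred_eq] at *
        omega
  · rintro (h5 | ⟨-, h5⟩)
    · exact Or.inl (Or.inl h5)
    · simp only [shape, Set.mem_ofPred_eq, not_and, not_lt] at h5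
      rcases le_or_gt (u + i) (h (u + i) + k) with h6 | h6
      · refine Or.inl (Or.inr ?_)
        rw [Set.mem_singleton_iff]
        omega
      · refine Or.inr ?_
        simp only [Set.mem_ofPred_eq]
        omega

theorem side_mem_full_choice (hk : 2 ≤ k) (hn : 2 * k + 1 ≤ n) (hP : P ∈ kTriangulations k n)
    (hc : (u, b) ∈ choices k n P) :
    ∀ y, u < y → y ≤ u + k → (choiceStar k u b y, y) ∈ full k n P := by
  intro y h1 h2
  have H := isStar_choiceStar hk hn hP hc
  have hku := (le_corner_of_two_mul_lt (by omega) hn hP).trans hc.1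
  obtain ⟨i, rfl⟩ := Nat.exists_eq_add_of_le h1.le
  rw [← mem_setB_iff H hk hc.2.1 (by omega) (by omega)]
  rcases h2.eq_or_lt with h3 | h3
  · obtain rfl : i = k := by omega
    have := H.add_eq _ le_rfl
    refine Or.inl (Or.inr ?_)
    rw [Set.mem_singleton_iff]
    omega
  · have hi : i ∈ Set.Icc 1 (k - 1) := by
      rw [Set.mem_Icc]
      omega
    rw [show choiceStar k u b (u + i) = b ⟨i, hi⟩ from choiceStar_add u b ⟨i, hi⟩]
    exact hc.2.2.1 ⟨i, hi⟩

/-- The child operation is inflating along the chosen star. -/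
theorem child_eq_inflate (hk : 2 ≤ k) (hn : 2 * k + 1 ≤ n) (hP : P ∈ kTriangulations k n)
    (hc : (u, b) ∈ choices k n P) :
    child k n P u b = inflate k u (choiceStar k u b) (full k n P) ∩ shape k (n + 1) := by
  have hPs := subset_shape (by omega) hP
  have H := isStar_choiceStar hk hn hP hc
  have hside := side_mem_full_choice hk hn hP hc
  have hku : k ≤ u := (le_corner_of_two_mul_lt (by omega) hn hP).trans hc.1
  have hun : u + k ≤ n := hc.2.1
  have hadd := choiceStar_add u b
  rw [child]
  set h := choiceStar k u b
  ext ⟨x, y⟩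
  simp only [Set.mem_union, Set.mem_inter_iff, mem_inflate, Set.mem_ofPred_eq,
    Set.mem_singleton_iff, Set.mem_range]
  constructor
  · rintro (((((⟨h1, h2⟩ | ⟨z, h1, rfl, h2⟩) | ⟨i, rfl, h1, h2⟩) | ⟨i, rfl, h1, h2⟩) | h1) |
      ⟨i, h1⟩)
    · refine ⟨Or.inl ⟨by rw [H.eq_zero y h1]; omega, subset_full h2⟩, ?_⟩
      have := hPs h2
      simp only [shape, Set.mem_ofPred_eq] at *
      omega
    · have h3 := hPs h2
      have h4 := H.add_eq z h1
      simp only [shape, Set.mem_ofPred_eq] at *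
      exact ⟨Or.inr ⟨z, rfl, Or.inl ⟨by omega, subset_full h2⟩⟩, by omega⟩
    · have h3 := hPs h2
      refine ⟨Or.inl ⟨by rwa [hadd i], subset_full h2⟩, ?_⟩
      simp only [shape, Set.mem_ofPred_eq] at *
      omega
    · have h3 := hPs h2
      refine ⟨Or.inr ⟨u + i, rfl, Or.inl ⟨by rwa [hadd i], subset_full h2⟩⟩, ?_⟩
      simp only [shape, Set.mem_ofPred_eq] at *
      omega
    · rw [Prod.mk.injEq] at h1
      obtain ⟨rfl, rfl⟩ := h1
      have := H.add_eq _ le_rfl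
      refine ⟨Or.inr ⟨x + k, rfl, Or.inr ⟨by omega, by omega, le_rfl⟩⟩, ?_⟩
      simp only [shape, Set.mem_ofPred_eq]
      omega
    · have hi := i.2
      simp only [Set.mem_Icc] at hi
      have h3 := H.add_le (show u < u + i by omega)
      have h4 := H.le_add (show u ≤ u + i by omega)
      rw [hadd i] at h3 h4
      rw [addedCross] at h1
      split_ifs at h1 with h2
      · rw [Prod.mk.injEq] at h1
        obtain ⟨rfl, rfl⟩ := h1
        have h5 := hside (u + i) (by omega) (by omega)
        rw [hadd i] at h5
        refine ⟨Or.inl ⟨(hadd i).le, h5⟩, ?_⟩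
        simp only [shape, Set.mem_ofPred_eq]
        omega
      · rw [Prod.mk.injEq] at h1
        obtain ⟨rfl, rfl⟩ := h1
        refine ⟨Or.inr ⟨u + i, rfl, Or.inr ⟨(hadd i).symm, by omega, by omega⟩⟩, ?_⟩
        simp only [shape, Set.mem_ofPred_eq]
        omega
  · rintro ⟨h1, h2⟩
    rcases h1 with ⟨h1, h3⟩ | ⟨z, rfl, ⟨h1, h3⟩ | ⟨rfl, h1, h3⟩⟩
    · rcases le_or_gt y u with h4 | h4
      · refine Or.inl (Or.inl (Or.inl (Or.inl (Or.inl ⟨h4, mem_of_mem_full h3 ?_⟩))))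
        simp only [shape, Set.mem_ofPred_eq] at *
        omega
      have h5 : y < u + k := by
        by_contra h5
        have := H.add_eq y (by omega)
        simp only [shape, Set.mem_ofPred_eq] at *
        omega
      obtain ⟨j, rfl⟩ := Nat.exists_eq_add_of_le h4.le
      obtain ⟨i, rfl⟩ : ∃ i : Set.Icc 1 (k - 1), (i : ℕ) = j :=
        ⟨⟨j, by simp only [Set.mem_Icc]; omega⟩, rfl⟩
      have h6 := H.le_add (show u ≤ u + i by omega)
      rw [hadd i] at h1 h6
      rcases h3 with h3 | ⟨-, h3⟩
      · exact Or.inl (Or.inl (Or.inl (Or.inr ⟨i, rfl, h1, h3⟩)))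
      · simp only [shape, Set.mem_ofPred_eq] at h2 h3
        refine Or.inr ⟨i, ?_⟩
        rw [addedCross, if_pos (by omega), Prod.mk.injEq]
        omega
    · have h4 := H.lt_of_pos h1
      have h5 := H.add_le h4
      have h6 : (x, z) ∈ P := by
        refine mem_of_mem_full h3 ?_
        simp only [shape, Set.mem_ofPred_eq] at *
        omega
      rcases le_or_gt (u + k) z with h7 | h7
      · exact Or.inl (Or.inl (Or.inl (Or.inl (Or.inr ⟨z, h7, rfl, h6⟩))))
      · obtain ⟨j, rfl⟩ := Nat.exists_eq_add_of_le h4.le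
        obtain ⟨i, rfl⟩ : ∃ i : Set.Icc 1 (k - 1), (i : ℕ) = j :=
          ⟨⟨j, by simp only [Set.mem_Icc]; omega⟩, rfl⟩
        rw [hadd i] at h1
        exact Or.inl (Or.inl (Or.inr ⟨i, rfl, h1, h6⟩))
    · rcases h3.eq_or_lt with rfl | h3
      · have := H.add_eq _ le_rfl
        refine Or.inl (Or.inr ?_)
        rw [Prod.mk.injEq]
        omega
      · obtain ⟨j, rfl⟩ := Nat.exists_eq_add_of_le h1.le
        obtain ⟨i, rfl⟩ : ∃ i : Set.Icc 1 (k - 1), (i : ℕ) = j :=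
          ⟨⟨j, by simp only [Set.mem_Icc]; omega⟩, rfl⟩
        refine Or.inr ⟨i, ?_⟩
        simp only [shape, Set.mem_ofPred_eq] at h2
        rw [hadd i] at h2 ⊢
        rw [addedCross, if_neg (by omega)]

theorem child_mem (hk : 2 ≤ k) (hn : 2 * k + 1 ≤ n) (hP : P ∈ kTriangulations k n)
    (hc : (u, b) ∈ choices k n P) : child k n P u b ∈ kTriangulations k (n + 1) := by
  rw [child_eq_inflate hk hn hP hc]
  exact inflate_mem hk (isStar_choiceStar hk hn hP hc)
    ((le_corner_of_two_mul_lt (by omega) hn hP).trans hc.1) hc.2.1 hP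
    (fun d hd => (row_le_corner_of_two_mul_lt (by omega) hn hP d hd).trans hc.1)
    (side_mem_full_choice hk hn hP hc)

theorem corner_child (hk : 2 ≤ k) (hn : 2 * k + 1 ≤ n) (hP : P ∈ kTriangulations k n)
    (hc : (u, b) ∈ choices k n P) : corner k (n + 1) (child k n P u b) = u := by
  have hT := child_mem hk hn hP hc
  have hg := isGreatest_corner (by omega) (by omega) hT
  have hku : k ≤ u := (le_corner_of_two_mul_lt (by omega) hn hP).trans hc.1
  have hun : u + k ≤ n := hc.2.1
  refine hg.unique ⟨⟨by omega, by omega, Or.inl (Or.inr rfl)⟩, ?_⟩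
  rintro a ⟨h1, h2, h3⟩
  rw [child_eq_inflate hk hn hP hc] at h3
  exact inflate_full_row_le (isStar_choiceStar hk hn hP hc)
    (fun d hd => (row_le_corner_of_two_mul_lt (by omega) hn hP d hd).trans hc.1) h3.1 h3.2

/-- A star of a `k`-triangulation at its corner is the one found by the indices `a_i`: a smaller
index would lie in a gap of the star. -/
theorem cornerStar_unique {T : Set (ℕ × ℕ)} (hk : 2 ≤ k) (hn : 2 * k + 2 ≤ n)
    (hT : T ∈ kTriangulations k n) {h : ℕ → ℕ} (H : IsStar k (corner k n T) h)
    (hs : HasSides k (corner k n T) h (full k n T)) : h = cornerStar k n T := by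
  have H' := isStar_cornerStar hk hn hT
  have hs' := hasSides_cornerStar hk hn hT
  have hfree := not_hasCrossing_full (by omega) hT
  -- the argument is symmetric in the two stars
  suffices ∀ h h' : ℕ → ℕ, IsStar k (corner k n T) h → HasSides k (corner k n T) h (full k n T) →
      IsStar k (corner k n T) h' → HasSides k (corner k n T) h' (full k n T) →
      ∀ j, h (corner k n T + j) = h' (corner k n T + j) →
        h' (corner k n T + j + 1) ≤ h (corner k n T + j + 1) by
    funext y
    rcases le_total y (corner k n T) with hy | hy
    · rw [H.eq_zero y hy, H'.eq_zero y hy]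
    obtain ⟨j, rfl⟩ := Nat.exists_eq_add_of_le hy
    induction j with
    | zero => rw [add_zero, H.eq_zero _ le_rfl, H'.eq_zero _ le_rfl]
    | succ j ih =>
      have h1 := ih (by omega)
      exact le_antisymm (this _ _ H' hs' H hs j h1.symm) (this _ _ H hs H' hs' j h1)
  intro h h' H hs H' hs' j hj
  by_contra! hlt
  have h1 := H.lt_succ (corner k n T + j) (by omega)
  rcases lt_or_ge j k with hjk | hjk
  · exact hfree (HasCrossing.of_gap H' hs' (hs _ (by omega) (by omega)).1 (by omega) (by omega)
      (hj ▸ h1) hlt)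
  · have h2 := H.add_eq (corner k n T + j + 1) (by omega)
    have h3 := H'.add_eq (corner k n T + j + 1) (by omega)
    omega

theorem cornerStar_child (hk : 2 ≤ k) (hn : 2 * k + 1 ≤ n) (hP : P ∈ kTriangulations k n)
    (hc : (u, b) ∈ choices k n P) :
    cornerStar k (n + 1) (child k n P u b) = choiceStar k u b := by
  refine (cornerStar_unique hk (by omega) (child_mem hk hn hP hc) ?_ ?_).symm
  · rw [corner_child hk hn hP hc]
    exact isStar_choiceStar hk hn hP hc
  · rw [corner_child hk hn hP hc, child_eq_inflate hk hn hP hc]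
    exact hasSides_inflate (isStar_choiceStar hk hn hP hc) hk hc.2.1
      (side_mem_full_choice hk hn hP hc)

theorem parent_child (hk : 2 ≤ k) (hn : 2 * k + 1 ≤ n) (hP : P ∈ kTriangulations k n)
    (hc : (u, b) ∈ choices k n P) : parent k (n + 1) (child k n P u b) = P := by
  rw [parent_eq_flatten hk hn (child_mem hk hn hP hc), cornerStar_child hk hn hP hc,
    child_eq_inflate hk hn hP hc]
  exact flatten_inflate_eq hk (isStar_choiceStar hk hn hP hc)
    ((le_corner_of_two_mul_lt (by omega) hn hP).trans hc.1) hc.2.1 hP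
    (fun d hd => (row_le_corner_of_two_mul_lt (by omega) hn hP d hd).trans hc.1)
    (side_mem_full_choice hk hn hP hc)

theorem corner_parent_le {T : Set (ℕ × ℕ)} (hk : 2 ≤ k) (hn : 2 * k + 1 ≤ n)
    (hT : T ∈ kTriangulations k (n + 1)) :
    corner k n (parent k (n + 1) T) ≤ corner k (n + 1) T := by
  have hP := parent_mem hk hn hT
  rcases hn.eq_or_lt with rfl | hn
  · rw [corner_eq_of_base (by omega) hP]
    exact le_corner (by omega) (by omega) hT
  · have h1 := (isGreatest_corner (by omega) hn hP).1.2.2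
    rw [parent_eq_flatten hk (by omega) hT] at h1 ⊢
    exact flatten_row_le (row_le_corner (by omega) (by omega) hT) _ h1.1

/-- Every `k`-triangulation is a child of its parent, for the choice given by its star. -/
theorem exists_choice {T : Set (ℕ × ℕ)} (hk : 2 ≤ k) (hn : 2 * k + 1 ≤ n)
    (hT : T ∈ kTriangulations k (n + 1)) :
    ∃ c ∈ choices k n (parent k (n + 1) T),
      child k n (parent k (n + 1) T) c.1 c.2 = T := by
  have hP := parent_mem hk hn hT
  have hle := corner_parent_le hk hn hT
  have H := isStar_cornerStar hk (by omega) hT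
  have hrow := row_le_corner (by omega) (by omega) hT
  have hkr := le_corner (by omega) (by omega) hT
  have hrn : corner k (n + 1) T + k ≤ n := by
    have := corner_add_lt hk (by omega) hT
    omega
  have hs := hasSides_cornerStar hk (by omega) hT
  have hside := side_mem_full_flatten H hk hrn hs
  have heq := inflate_flatten_eq hk H hkr hrn hT hrow hs
  rw [← parent_eq_flatten hk hn hT] at hside heq
  set r := corner k (n + 1) T
  set h := cornerStar k (n + 1) T
  set b : Set.Icc 1 (k - 1) → ℕ := fun i => h (r + i) with hb
  have hc : (r, b) ∈ choices k n (parent k (n + 1) T) := by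
    refine ⟨hle, hrn, fun i => ?_, fun i j hij => H.lt (by omega) (Nat.add_lt_add_left hij r)⟩
    have hi := i.2
    simp only [Set.mem_Icc] at hi
    exact (mem_setB_iff H hk hrn hi.1 (by omega)).2 (hside _ (by omega) (by omega))
  have hstar : choiceStar k r b = h := by
    have H' := isStar_choiceStar hk hn hP hc
    funext y
    rcases le_total y r with hy | hy
    · rw [H.eq_zero y hy, H'.eq_zero y hy]
    rcases le_or_gt (r + k) y with hy' | hy'
    · have h1 := H.add_eq y hy'
      have h2 := H'.add_eq y hy'
      omega
    obtain ⟨i, rfl⟩ := Nat.exists_eq_add_of_le hy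
    rcases Nat.eq_zero_or_pos i with rfl | hi
    · rw [add_zero, H.eq_zero _ le_rfl, H'.eq_zero _ le_rfl]
    · exact choiceStar_add r b ⟨i, by simp only [Set.mem_Icc]; omega⟩
  refine ⟨(r, b), hc, ?_⟩
  rw [child_eq_inflate hk hn hP hc, hstar, heq]

theorem bijOn_child (hk : 2 ≤ k) (hn : 2 * k + 1 ≤ n) (hP : P ∈ kTriangulations k n) :
    Set.BijOn (fun c : ℕ × (Set.Icc 1 (k - 1) → ℕ) => child k n P c.1 c.2) (choices k n P)
      {T | T ∈ kTriangulations k (n + 1) ∧ parent k (n + 1) T = P} := by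
  refine ⟨fun c hc => ⟨child_mem hk hn hP hc, parent_child hk hn hP hc⟩, ?_, ?_⟩
  · rintro ⟨u, b⟩ hc ⟨u', b'⟩ hc' heq
    simp only at heq
    have h1 := corner_child hk hn hP hc
    rw [heq, corner_child hk hn hP hc'] at h1
    subst h1
    have h2 := cornerStar_child hk hn hP hc
    rw [heq, cornerStar_child hk hn hP hc'] at h2
    rw [Prod.mk.injEq]
    refine ⟨rfl, funext fun i => ?_⟩
    rw [← choiceStar_add u' b i, ← h2, choiceStar_add]
  · rintro T ⟨hT, rfl⟩
    exact exists_choice hk hn hT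

end

/-! ### The generating tree -/

section
variable {V : Type*} {R : V → V → Prop} {level : V → ℕ} {root : V}

/-- A parent relation that raises the level by one, with unique parents for all vertices except a
single one at level `0`, defines a tree: an edge from `x` to its child `y` is a bridge because
without it no edge leaves the set of descendants of `y`. -/
theorem isTree_fromRel (hlevel : ∀ x y, R x y → level y = level x + 1)
    (huniq : ∀ x x' y, R x y → R x' y → x = x') (hex : ∀ y, level y ≠ 0 → ∃ x, R x y)
    (hroot : level root = 0) (hroot' : ∀ x, level x = 0 → x = root) :
    (SimpleGraph.fromRel R).IsTree ∧
      ∀ x, (SimpleGraph.fromRel R).dist root x = level x := by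
  set G := SimpleGraph.fromRel R with hG
  have hadj : ∀ x y, R x y → G.Adj x y := by
    intro x y hxy
    rw [hG, SimpleGraph.fromRel_adj]
    refine ⟨?_, Or.inl hxy⟩
    rintro rfl
    have := hlevel _ _ hxy
    omega
  have hwalk : ∀ l x, level x = l → ∃ w : G.Walk root x, w.length = l := by
    intro l
    induction l with
    | zero =>
      intro x hx
      obtain rfl := hroot' x hx
      exact ⟨SimpleGraph.Walk.nil, rfl⟩
    | succ l ih =>
      intro x hx
      obtain ⟨y, hy⟩ := hex x (by omega)
      obtain ⟨w, hw⟩ := ih y (by have := hlevel _ _ hy; omega)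
      exact ⟨w.concat (hadj _ _ hy), by rw [SimpleGraph.Walk.length_concat, hw]⟩
  have hlip : ∀ x y (w : G.Walk x y), level y ≤ level x + w.length := by
    intro x y w
    induction w with
    | nil => simp
    | cons hxy w ih =>
      rw [SimpleGraph.Walk.length_cons]
      rw [hG, SimpleGraph.fromRel_adj] at hxy
      rcases hxy.2 with h | h
      · have := hlevel _ _ h
        omega
      · have := hlevel _ _ h
        omega
  have hreach : ∀ x, G.Reachable root x := fun x =>
    let ⟨w, _⟩ := hwalk _ x rfl
    ⟨w⟩
  refine ⟨⟨?_, ?_⟩, fun x => ?_⟩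
  · have : Nonempty V := ⟨root⟩
    exact ⟨fun x y => (hreach x).symm.trans (hreach y)⟩
  · rw [SimpleGraph.isAcyclic_iff_forall_adj_isBridge]
    have key : ∀ x y, R x y → ¬ (G.deleteEdges {s(x, y)}).Reachable y x := by
      rintro x y hxy ⟨w⟩
      have hdesc : ∀ z, Relation.ReflTransGen R y z → level y ≤ level z := by
        intro z hz
        induction hz with
        | refl => exact le_rfl
        | tail _ h ih =>
          have := hlevel _ _ h
          omega
      have hinv : ∀ a b (w : (G.deleteEdges {s(x, y)}).Walk a b),
          Relation.ReflTransGen R y a → Relation.ReflTransGen R y b := by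
        intro a b w
        induction w with
        | nil => exact id
        | @cons a b c hab w ih =>
          intro ha
          refine ih ?_
          rw [SimpleGraph.deleteEdges_adj, hG, SimpleGraph.fromRel_adj] at hab
          obtain ⟨⟨-, h1 | h1⟩, h2⟩ := hab
          · exact ha.tail h1
          · rcases Relation.ReflTransGen.cases_tail ha with h3 | ⟨c, h3, h4⟩
            · subst h3
              obtain rfl := huniq _ _ _ h1 hxy
              exact absurd (Sym2.eq_swap) h2
            · rwa [huniq _ _ _ h1 h4]
      have h1 := hdesc x (hinv y x w Relation.ReflTransGen.refl)
      have h2 := hlevel _ _ hxy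
      omega
    intro x y hxy
    rw [SimpleGraph.isBridge_iff]
    rw [hG, SimpleGraph.fromRel_adj] at hxy
    rcases hxy.2 with h | h
    · exact fun hr => key x y h hr.symm
    · rw [Sym2.eq_swap]
      exact key y x h
  · obtain ⟨w, hw⟩ := hwalk _ x rfl
    obtain ⟨w', hw'⟩ := (hreach x).exists_walk_length_eq_dist
    have h1 := SimpleGraph.dist_le w
    have h2 := hlip _ _ w'
    omega

end

theorem isTree_generatingTree {k : ℕ} (hk : 2 ≤ k) :
    (generatingTree k).IsTree ∧
      ∃ root : Node k, root.1 = 0 ∧ (root.2 : Set (ℕ × ℕ)) = ∅ ∧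
        ∀ x : Node k, (generatingTree k).dist root x = x.1 := by
  have hmem : ∅ ∈ kTriangulations k (0 + 2 * k + 1) := by
    rw [zero_add, kTriangulations_base (by omega)]
    exact Set.mem_singleton _
  have huniq : ∀ x x' y : Node k, IsParent x y → IsParent x' y → x = x' := by
    rintro ⟨l, T, hT⟩ ⟨l', T', hT'⟩ y ⟨h1, h2⟩ ⟨h3, h4⟩
    obtain rfl : l = l' := by
      simp only at h1 h3
      omega
    obtain rfl : T = T' := h2.trans h4.symm
    rfl
  have hex : ∀ y : Node k, y.1 ≠ 0 → ∃ x, IsParent x y := by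
    rintro ⟨l, T, hT⟩ hl
    obtain ⟨m, rfl⟩ : ∃ m, l = m + 1 := Nat.exists_eq_succ_of_ne_zero hl
    have hm : m + 1 + 2 * k + 1 = m + 2 * k + 1 + 1 := by omega
    have hT' : T ∈ kTriangulations k (m + 2 * k + 1 + 1) := hm ▸ hT
    exact ⟨⟨m, _, parent_mem hk (by omega) hT'⟩, rfl, by simp only [hm]⟩
  have hroot : ∀ x : Node k, x.1 = 0 → x = ⟨0, ∅, hmem⟩ := by
    rintro ⟨l, T, hT⟩ hl
    obtain rfl : l = 0 := hl
    obtain rfl : T = ∅ := eq_empty_of_mem (k := k) (by omega) (by rwa [zero_add] at hT)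
    rfl
  have h := isTree_fromRel (R := IsParent (k := k)) (level := Sigma.fst)
    (fun x y h => h.1) huniq hex rfl hroot
  exact ⟨h.1, _, rfl, rfl, h.2⟩

end KTri

theorem mainTheorem4 (k : ℕ) (hk : 2 ≤ k) :
    -- corner, indices, the lemma on the `a_i`, and the parent operation
    (∀ n : ℕ, 2 * k + 2 ≤ n → ∀ T ∈ KTri.kTriangulations k n, ∀ r : ℕ, r = KTri.corner k n T →
      IsGreatest (KTri.shortRows k n T) r ∧ k ≤ r ∧
      (∀ d ∈ T, d.1 ≤ r) ∧
      (∀ i : ℕ, 1 ≤ i → i ≤ k →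
        IsLeast {a | a ∈ KTri.setA k r T i ∧ (i = 1 ∨ KTri.idxA k r T (i - 1) < a)}
          (KTri.idxA k r T i)) ∧
      (∀ i : ℕ, 1 ≤ i → i ≤ k →
        (KTri.idxA k r T i, r + i + 1) ∈ T ∨
          KTri.IsTrivial k n (KTri.idxA k r T i, r + i + 1)) ∧
      (∀ a : ℕ, (a, r + k) ∈ T → a ≤ KTri.idxA k r T (k - 1)) ∧
      KTri.parent k n T ∈ KTri.kTriangulations k (n - 1)) ∧
    -- the generating tree: its root, and the tree with its levels
    (KTri.kTriangulations k (2 * k + 1) = {∅} ∧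
      (KTri.generatingTree k).IsTree ∧
      ∃ root : KTri.Node k, root.1 = 0 ∧ (root.2 : Set (ℕ × ℕ)) = ∅ ∧
        ∀ x : KTri.Node k, (KTri.generatingTree k).dist root x = x.1) ∧
    -- the children
    (∀ n : ℕ, 2 * k + 1 ≤ n → ∀ T ∈ KTri.kTriangulations k n,
      Set.BijOn (fun c : ℕ × (Set.Icc 1 (k - 1) → ℕ) => KTri.child k n T c.1 c.2)
        (KTri.choices k n T)
        {T' | T' ∈ KTri.kTriangulations k (n + 1) ∧ KTri.parent k (n + 1) T' = T} ∧
      (∀ c ∈ KTri.choices k n T,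
        KTri.corner k (n + 1) (KTri.child k n T c.1 c.2) = c.1) ∧
      (∀ T' ∈ KTri.kTriangulations k (n + 1), KTri.parent k (n + 1) T' = T →
        KTri.corner k n T ≤ KTri.corner k (n + 1) T')) := by
  
  have hk1 : 1 ≤ k := by omega
  refine ⟨?_, ⟨KTri.kTriangulations_base hk1, KTri.isTree_generatingTree hk⟩, ?_⟩
  · rintro n hn T hT r rfl
    refine ⟨KTri.isGreatest_corner hk1 hn hT, KTri.le_corner hk1 hn hT,
      KTri.row_le_corner hk1 hn hT,
      fun i hi _ => KTri.isLeast_idxA (KTri.subset_shape hk1 hT) (KTri.le_corner hk1 hn hT) i hi,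
      fun i hi hik => KTri.idxA_side hk hn hT hi hik,
      fun a ha => KTri.row_le_idxA_pred hk hn hT ha, ?_⟩
    obtain ⟨m, rfl⟩ : ∃ m, n = m + 1 := ⟨n - 1, by omega⟩
    exact KTri.parent_mem hk (by omega) hT
  · intro n hn T hT
    refine ⟨KTri.bijOn_child hk hn hT, fun c hc => KTri.corner_child hk hn hT hc, ?_⟩
    rintro T' hT' rfl
    exact KTri.corner_parent_le hk hn hT'
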